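/- \textbf{Setting.} A logic $\mathcal L$ consists of a set of sentences and a model-based consequence relation $\models$ ($\Gamma\models\alpha$ iff every model of all elements of $\Gamma$ is a model of $\alpha$); every sentence $\alpha$ has a size $|\alpha|\in\mathbb N$, and $|\mathcal T|=\sum_{\alpha\in\mathcal T}|\alpha|$ for a finite theory $\mathcal T$. Sentences are represented by binary words via an injective encoding such that $|\alpha|$ is polynomially bounded in the length of the word of $\alpha$. A hypergraph $H=(V,E,\ell)$ has a finite vertex set $V$, hyperedges $(S,d)$ with $S\subseteq V$, $d\in V$, and a labelling $\ell$ of vertices by sentences; its size is $|H|=\sum_{(S,d)\in E}\bigl(|\ell(d)|+\sum_{v\in S}|\ell(v)|\bigr)$. A leaf is a vertex without incoming hyperedges (a hyperedge $(\emptyset,v)$ is incoming at $v$), a sink a vertex without outgoing ones. A derivation structure over $\mathcal T$ is a hypergraph in which every leaf is labelled by an element of $\mathcal T$ and $\{\ell(s)\mid s\in S\}\models\ell(d)$ for every hyperedge $(S,d)$. A proof for $\mathcal T\models\eta$ is a derivation structure over $\mathcal T$ without cycles (paths of positive length from a vertex to itself) that has exactly one sink, which is labelled by $\eta$. A deriver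 $\mathfrak D$ is given by a set $C$ of sentences and a map assigning to every finite theory $\mathcal T$ and every $\eta\in C$ a derivation structure $\mathfrak D(\mathcal T,\eta)$ over $\mathcal T$ such that $\mathcal T\models\eta$ iff some substructure of $\mathfrak D(\mathcal T,\eta)$ is a proof for $\mathcal T\models\eta$. It is exponential if $|\mathfrak D(\mathcal T,\eta)|\le 2^{p(|\mathcal T|+|\eta|)}$ for some polynomial $p$ and all $\mathcal T,\eta$. A proof $\mathcal P$ for $\mathcal T\models\eta$ is admissible if there is a homomorphism from $\mathcal P$ to $\mathfrak D(\mathcal T,\eta)$, i.e. a map of vertices that preserves labels and maps hyperedges to hyperedges. The problem $\mathsf{MP}^{\exp}_{\mathsf{unary}}(\mathfrak D)$, for an exponential deriver $\mathfrak D$, is to decide, given a finite theory $\mathcal T$ (as a list of sentences), a sentence $\eta\in C$ and a number $n\in\mathbb N$ in unary, whether there is an admissible proof for $\mathcal T\models\eta$ with at most $n$ vertices. The vertices of each $\mathfrak D(\mathcal T,\eta)$ are numbered consecutively $1,\dots,m$, where the length of the binary notation of $m$ is bounded by a polynomial in $|\mathcal T|+|\eta|$. On input $(\mathcal T,\eta,n)$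 an algorithm can access $\mathfrak D(\mathcal T,\eta)=(V,E,\ell)$ only through an oracle that answers, in one step, queries of the form ``is $(\{v_1,\dots,v_{l-1}\},v_l)\in E$?'' and ``is $\ell(v)=\alpha$?'', where vertices are given by their indices in binary and $\alpha$ is a sentence. \textbf{Theorem.} For every exponential deriver $\mathfrak D$ with such a numbering, $\mathsf{MP}^{\exp}_{\mathsf{unary}}(\mathfrak D)$ is in \textsc{NP} relative to this oracle access: there are a deterministic oracle Turing machine $M$ and polynomials $q,t$ such that, for every instance with input word $x$, the machine $M$ (with the oracle of this instance) halts within $t(|x|)$ steps on $x$ and every certificate $w$ with $|w|\le q(|x|)$, and the instance is a yes-instance iff $M$ accepts $x$ together with some such $w$. -/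

import Mathlib

universe u v w

/-! ### Logics -/

set_option linter.checkUnivs false in
/-- A logic with a model-based consequence relation and a notion of size of sentences. -/
structure SentLogic where
  Sentence : Type u
  Model : Type v
  Sat : Model → Sentence → Prop
  size : Sentence → ℕ

namespace SentLogic

variable (L : SentLogic.{u, v})

/-- `Γ ⊨ α`: every model of all elements of `Γ` is a model of `α`. -/
def Entails (Γ : Set L.Sentence) (α : L.Sentence) : Prop :=
  ∀ M : L.Model, (∀ β ∈ Γ, L.Sat M β) → L.Sat M α

/-- The size `|T|` of a finite theory. -/
def theorySize (T : Finset L.Sentence) : ℕ := ∑ α ∈ T, L.size α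

end SentLogic

/-- A representation of the sentences of a logic by binary words, as needed to hand sentences to a
machine. The size of a sentence is polynomially bounded in the length of the word. -/
structure SentenceCoding (L : SentLogic.{u, v}) where
  enc : L.Sentence → List Bool
  enc_injective : Function.Injective enc
  size_le : ∃ p : Polynomial ℕ, ∀ α, L.size α ≤ p.eval (enc α).length

/-! ### Hypergraphs, derivation structures and proofs -/

/-- A directed hypergraph with finite vertex set `V` inside a type `U`, whose vertices are labelled
by elements of `S`. Only the values of `label` on `V` matter. -/
structure LHypergraph (U : Type w) (S : Type u) where
  V : Finset U
  E : Finset (Finset U × U)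
  label : U → S
  edge_mem : ∀ e ∈ E, e.1 ⊆ V ∧ e.2 ∈ V

namespace LHypergraph

variable {U : Type w} {S : Type u}

/-- A leaf is a vertex without incoming hyperedges. -/
def IsLeaf (H : LHypergraph U S) (x : U) : Prop :=
  x ∈ H.V ∧ ∀ e ∈ H.E, e.2 ≠ x

/-- A sink is a vertex without outgoing hyperedges. -/
def IsSink (H : LHypergraph U S) (x : U) : Prop :=
  x ∈ H.V ∧ ∀ e ∈ H.E, x ∉ e.1

/-- A path of length one: some hyperedge leads from a set containing `x` to `y`. -/
def Step (H : LHypergraph U S) (x y : U) : Prop :=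
  ∃ e ∈ H.E, x ∈ e.1 ∧ e.2 = y

/-- There is no path of positive length from a vertex to itself. -/
def Acyclic (H : LHypergraph U S) : Prop :=
  ∀ x, ¬ Relation.TransGen H.Step x x

/-- `H'` is a substructure of `H`. -/
def IsSubstructure (H' H : LHypergraph U S) : Prop :=
  H'.V ⊆ H.V ∧ H'.E ⊆ H.E ∧ ∀ x ∈ H'.V, H'.label x = H.label x

open Classical in
/-- `h` is a homomorphism from `H` to `H'`. -/
def IsHom {U₁ : Type*} {U₂ : Type*} (H : LHypergraph U₁ S) (H' : LHypergraph U₂ S)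
    (h : U₁ → U₂) : Prop :=
  (∀ x ∈ H.V, h x ∈ H'.V) ∧
  (∀ e ∈ H.E, (e.1.image h, h e.2) ∈ H'.E) ∧
  ∀ x ∈ H.V, H'.label (h x) = H.label x

/-- The size of a hypergraph: the sum over all hyperedges of the sizes of their labels. -/
def hsize {L : SentLogic.{u, v}} (H : LHypergraph U L.Sentence) : ℕ :=
  ∑ e ∈ H.E, (L.size (H.label e.2) + ∑ x ∈ e.1, L.size (H.label x))

/-- A derivation structure over the finite theory `T`: a grounded and sound hypergraph. -/
def IsDerivationStructure (L : SentLogic.{u, v}) (T : Finset L.Sentence)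
    (H : LHypergraph U L.Sentence) : Prop :=
  (∀ x, H.IsLeaf x → H.label x ∈ T) ∧
  ∀ e ∈ H.E, L.Entails (H.label '' (e.1 : Set U)) (H.label e.2)

/-- A proof for `T ⊨ η`: an acyclic derivation structure over `T` with exactly one sink, which is
labelled by `η`. -/
def IsProof (L : SentLogic.{u, v}) (T : Finset L.Sentence) (η : L.Sentence)
    (H : LHypergraph U L.Sentence) : Prop :=
  H.IsDerivationStructure L T ∧
  (∃ x, H.IsSink x ∧ H.label x = η ∧ ∀ y, H.IsSink y → y = x) ∧
  H.Acyclic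

end LHypergraph

/-! ### Derivers -/

/-- A deriver: a set `C` of allowed consequences and a function assigning to every finite theory `T`
and every `η ∈ C` a derivation structure over `T` that contains a proof for `T ⊨ η` if and only if
`T` entails `η`. -/
structure Deriver (L : SentLogic.{u, v}) where
  C : Set L.Sentence
  Vertex : Type w
  graph : Finset L.Sentence → C → LHypergraph Vertex L.Sentence
  isDerivationStructure : ∀ T η, (graph T η).IsDerivationStructure L T
  complete : ∀ (T : Finset L.Sentence) (η : C), L.Entails (T : Set L.Sentence) (η : L.Sentence) ↔
    ∃ P : LHypergraph Vertex L.Sentence, P.IsSubstructure (graph T η) ∧ P.IsProof L T η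

namespace Deriver

variable {L : SentLogic.{u, v}}

/-- The size of the derivation structure is at most exponential in `|T| + |η|`. -/
def IsExponential (D : Deriver.{u, v, w} L) : Prop :=
  ∃ p : Polynomial ℕ, ∀ T (η : D.C),
    (D.graph T η).hsize ≤ 2 ^ p.eval (L.theorySize T + L.size η)

/-- A consecutive numbering `1, …, m` of the vertices of every derivation structure produced by the
deriver. -/
structure Numbering (D : Deriver.{u, v, w} L) where
  num : Finset L.Sentence → D.C → D.Vertex → ℕ
  bijOn : ∀ T η, Set.BijOn (num T η) (D.graph T η).V (Set.Icc 1 (D.graph T η).V.card)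

/-- The binary notation of the largest index `m` has length polynomial in `|T| + |η|`. -/
def Numbering.HasPolynomialIndices {D : Deriver.{u, v, w} L} (_N : D.Numbering) : Prop :=
  ∃ p : Polynomial ℕ, ∀ T (η : D.C),
    (D.graph T η).V.card.size ≤ p.eval (L.theorySize T + L.size η)

/-- An instance of the minimal proof problem: a finite theory, presented as a list of its sentences,
an allowed consequence, and a natural number. -/
structure MPInstance (D : Deriver.{u, v, w} L) where
  axioms : List L.Sentence
  goal : D.C
  bound : ℕ

open Classical in
/-- The finite theory of an instance. -/
noncomputable def MPInstance.theory {D : Deriver.{u, v, w} L} (i : D.MPInstance) :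
    Finset L.Sentence := i.axioms.toFinset

/-- The derivation structure of an instance. -/
noncomputable def MPInstance.derivation {D : Deriver.{u, v, w} L} (i : D.MPInstance) :
    LHypergraph D.Vertex L.Sentence := D.graph i.theory i.goal

/-- The yes-instances: there is an admissible proof with at most `bound` vertices, that is, a proof
for `T ⊨ η` having a homomorphism into the derivation structure of the instance. -/
def MP (D : Deriver.{u, v, w} L) : Set D.MPInstance :=
  {i | ∃ (U : Type) (P : LHypergraph U L.Sentence), P.IsProof L i.theory i.goal ∧
    (∃ h : U → D.Vertex, P.IsHom i.derivation h) ∧ P.V.card ≤ i.bound}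

end Deriver

/-! ### Words: input and oracle queries -/

/-- The alphabet for inputs, certificates and oracle queries. -/
inductive MPSym
  | bit (b : Bool)
  | vertex
  | sentence
  | goal
  | bound
  | edge
  | label
  deriving DecidableEq, Fintype

namespace Deriver

variable {L : SentLogic.{u, v}} {D : Deriver.{u, v, w} L}

/-- The binary word of a sentence. -/
def sentenceWord (c : SentenceCoding L) (α : L.Sentence) : List MPSym := (c.enc α).map MPSym.bit

/-- The binary notation of a vertex index (least significant bit first), preceded by a marker. -/
def indexWord (k : ℕ) : List MPSym := MPSym.vertex :: (Computability.encodeNat k).map MPSym.bit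

/-- The input word of an instance. The number `bound` is written in unary. -/
def MPInstance.encode (c : SentenceCoding L) (i : D.MPInstance) : List MPSym :=
  (i.axioms.flatMap fun α => MPSym.sentence :: sentenceWord c α) ++
    (MPSym.goal :: sentenceWord c i.goal) ++
    (MPSym.bound :: List.replicate i.bound (MPSym.bit true))

/-- The query word asking whether `({k₁, …, kᵣ}, k)` is a hyperedge, where `ks = [k₁, …, kᵣ]`. -/
def edgeQuery (ks : List ℕ) (k : ℕ) : List MPSym :=
  MPSym.edge :: ((ks ++ [k]).flatMap indexWord)

/-- The query word asking whether the vertex with index `k` has label `α`. -/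
def labelQuery (c : SentenceCoding L) (k : ℕ) (α : L.Sentence) : List MPSym :=
  MPSym.label :: (indexWord k ++ MPSym.sentence :: sentenceWord c α)

open Classical in
/-- The oracle for an instance: the set of all edge queries and label queries about its derivation
structure whose answer is `true`. All other words are answered by `false`. -/
def MPInstance.oracle (c : SentenceCoding L) (N : D.Numbering) (i : D.MPInstance) :
    Set (List MPSym) :=
  {q | (∃ (xs : List D.Vertex) (x : D.Vertex), (xs.toFinset, x) ∈ i.derivation.E ∧
      q = edgeQuery (xs.map (N.num i.theory i.goal)) (N.num i.theory i.goal x)) ∨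
    ∃ (x : D.Vertex) (α : L.Sentence), x ∈ i.derivation.V ∧ i.derivation.label x = α ∧
      q = labelQuery c (N.num i.theory i.goal x) α}

end Deriver

/-! ### Oracle Turing machines and NP -/

/-- A deterministic oracle Turing machine with finitely many stacks over the finite alphabet `A`,
finitely many labels and finitely many internal states. At each label there is either an ordinary
statement of the multi-stack model `Turing.TM2`, or an oracle call with the labels at which the
machine continues after a positive or negative answer. -/
structure OracleTM (A : Type) where
  K : Type
  [decK : DecidableEq K]
  [finK : Fintype K]
  Λ : Type
  [finΛ : Fintype Λ]
  σ : Type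
  [finσ : Fintype σ]
  inputStack : K
  certStack : K
  queryStack : K
  input_ne_cert : inputStack ≠ certStack
  input_ne_query : inputStack ≠ queryStack
  cert_ne_query : certStack ≠ queryStack
  main : Λ
  initialState : σ
  accepting : σ → Bool
  prog : Λ → Turing.TM2.Stmt (fun _ : K => A) Λ σ ⊕ (Bool → Λ)

attribute [instance] OracleTM.decK

namespace OracleTM

variable {A : Type} (M : OracleTM A)

/-- Configurations: current label (`none` if halted), internal state, contents of the stacks. -/
abbrev Cfg : Type := Turing.TM2.Cfg (fun _ : M.K => A) M.Λ M.σ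

/-- The initial configuration on an input word `x` and a certificate `w`; the first symbol of each
word is on top of its stack. -/
def initCfg (x w : List A) : M.Cfg where
  l := some M.main
  var := M.initialState
  stk k := if k = M.inputStack then x else if k = M.certStack then w else []

open Classical in
/-- One step with oracle `O`; a halted configuration is not changed. An oracle call takes one step:
it asks whether the word written on the query stack (in the order in which it was written, so read
from the bottom to the top) belongs to `O`, and erases the query stack. -/
noncomputable def step (O : Set (List A)) (c : M.Cfg) : M.Cfg :=
  match c.l with
  | none => c
  | some l =>
    match M.prog l with
    | Sum.inl s => Turing.TM2.stepAux s c.var c.stk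
    | Sum.inr next =>
      ⟨some (next (decide ((c.stk M.queryStack).reverse ∈ O))), c.var,
        Function.update c.stk M.queryStack []⟩

/-- The configuration reached after at most `t` steps on input `x` and certificate `w`. -/
noncomputable def run (O : Set (List A)) (x w : List A) (t : ℕ) : M.Cfg :=
  (M.step O)^[t] (M.initCfg x w)

/-- The machine halts within `t` steps. -/
def HaltsWithin (O : Set (List A)) (x w : List A) (t : ℕ) : Prop :=
  (M.run O x w t).l = none

/-- The machine halts in an accepting state within `t` steps. -/
def AcceptsWithin (O : Set (List A)) (x w : List A) (t : ℕ) : Prop :=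
  (M.run O x w t).l = none ∧ M.accepting (M.run O x w t).var = true

end OracleTM

/-- A decision problem `Y` on instances `I`, given by input words `enc i`, is in NP with oracle access
to `O i` on instance `i`: there are a single oracle machine and polynomials `q`, `t` such that on
every instance `i` and every certificate of length at most `q(|enc i|)` the machine halts within
`t(|enc i|)` steps, and `i` is a yes-instance iff some such certificate is accepted. -/
def InOracleNP {A : Type} {I : Type*} [Fintype A] (enc : I → List A) (O : I → Set (List A)) (Y : Set I) :
    Prop :=
  ∃ (M : OracleTM A) (q t : Polynomial ℕ),
    (∀ i w, w.length ≤ q.eval (enc i).length →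
      M.HaltsWithin (O i) (enc i) w (t.eval (enc i).length)) ∧
    ∀ i, i ∈ Y ↔ ∃ w, w.length ≤ q.eval (enc i).length ∧
      M.AcceptsWithin (O i) (enc i) w (t.eval (enc i).length)

/-! ### The verifying machine -/

namespace ProofChecker

/-! An admissible proof amounts to a short derivation inside the given structure. Listing the
vertices of an acyclic proof with premises first and applying the homomorphism gives a list of
vertices of the structure, each labelled by an axiom or reached by a hyperedge from earlier entries.
Conversely, choose one justification for each position of such a list and keep the positions that
lead to the goal: they form a proof, and sending a position to its vertex is a homomorphism. Entries
may repeat, and an entry may count as an axiom even if it is no leaf of the structure. This is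
`Deriver.mem_MP_iff`; the vertex bound becomes a bound on the length of the list, polynomial in the
input because it is written in unary.

A certificate spells out such a list, one line per entry: a selection of earlier entries, the new
index, a selection of axioms. The machine keeps the derived indices in front of the input on one
stack. A single pass per line copies the selected words into a query, stores the new index and
deletes one symbol of the unary bound; a final line asks whether a derived vertex carries the goal.
Well-formedness of the query is never checked: the oracle set contains only genuine queries, and
marked words are uniquely readable (`items_inj`), so a positive answer itself shows that the line is
legal. Soundness is `exists_derivation_of_accepts`, completeness `exists_accepts_of_derivation`.

Running time is controlled by a potential in which one certificate symbol outweighs a whole pass and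
its restoration (`step_potential`). Certificates are polynomial because there are at most `bound`
lines, and indices are polynomially long in sizes that are themselves polynomial in the input
length. -/

/-- The contents of the proof checker: the store (initially the input), an auxiliary stack receiving
the part of the store already read, the certificate, and the query. -/
inductive Stack
  | store
  | aux
  | cert
  | query
  deriving DecidableEq

instance : Fintype Stack :=
  ⟨{.store, .aux, .cert, .query}, fun k => by cases k <;> decide⟩

/-- The labels of the proof checker. -/
inductive Lbl
  | start
  | line
  | walk
  | word
  | ask
  | yes
  | no
  | restore
  deriving DecidableEq

instance : Fintype Lbl :=
  ⟨{.start, .line, .walk, .word, .ask, .yes, .no, .restore}, fun l => by cases l <;> decide⟩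

/-- The internal state: whether the current item is copied to the query, whether the current line is
the final one, whether the machine has accepted, and the symbol read last. -/
structure State where
  sel : Bool
  fin : Bool
  acc : Bool
  cur : Option MPSym
  deriving DecidableEq, Fintype

/-- Is the symbol a bit? -/
def isBit : Option MPSym → Bool
  | some (.bit _) => true
  | _ => false

open Turing.TM2.Stmt in
/-- Push the current symbol on the auxiliary stack, and on the query stack if it is selected. -/
def copyCur : Turing.TM2.Stmt (fun _ : Stack => MPSym) Lbl State :=
  -- The default is never used: this code is entered only after `cur` has been found to be a symbol.
  push .aux (fun v => v.cur.getD .edge) <|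
  branch (fun v => v.sel) (push .query (fun v => v.cur.getD .edge) <| goto fun _ => .walk)
    (goto fun _ => .walk)

open Turing.TM2.Stmt in
/-- The program of the proof checker. -/
def program : Lbl → Turing.TM2.Stmt (fun _ : Stack => MPSym) Lbl State ⊕ (Bool → Lbl)
  -- The symbol `.edge` does not occur in inputs; on the store it separates the derived indices
  -- above it from the axioms below it.
  | .start => .inl <| push .store (fun _ => .edge) <| goto fun _ => .line
  | .line => .inl <|
      pop .cert (fun _ s => ⟨false, decide (s = some .goal), false, s⟩) <|
      branch (fun v => decide (v.cur = some .edge ∨ v.cur = some .label ∨ v.cur = some .goal))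
        -- The final line, marked `.goal`, also poses a label query.
        (push .query (fun v => if v.cur = some .edge then .edge else .label) <| goto fun _ => .walk)
        halt
  | .walk => .inl <|
      pop .store (fun v s => { v with cur := s }) <|
      branch (fun v => v.cur.isNone) (goto fun _ => .ask) <|
      branch (fun v => isBit v.cur) copyCur <|
      branch (fun v => decide (v.cur = some .vertex ∨ v.cur = some .sentence))
        (pop .cert (fun v s => { v with sel := decide (s = some (.bit true)) }) copyCur) <|
      -- On an ordinary line the separator is the insertion point: `.vertex` replaces it, the new
      -- index follows from the certificate, and the separator is put back behind it.
      branch (fun v => decide (v.cur = some .edge))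
        (load (fun v => { v with sel := false }) <|
          branch (fun v => v.fin) copyCur <|
          push .aux (fun _ => .vertex) <| push .query (fun _ => .vertex) <| goto fun _ => .word) <|
      branch (fun v => decide (v.cur = some .goal))
        (push .aux (fun _ => .goal) <| load (fun v => { v with sel := v.fin }) <|
          branch (fun v => v.fin) (push .query (fun _ => .sentence) <| goto fun _ => .walk)
            (goto fun _ => .walk)) <|
      -- Each ordinary line pays with one symbol of the unary bound; if none is left, the machine
      -- halts without accepting.
      push .aux (fun _ => .bound) <| load (fun v => { v with sel := false }) <|
        branch (fun v => v.fin) (goto fun _ => .walk) <|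
        pop .store (fun v s => { v with cur := s }) <|
        branch (fun v => v.cur.isNone) halt (goto fun _ => .walk)
  | .word => .inl <|
      pop .cert (fun v s => { v with cur := s }) <|
      branch (fun v => v.cur.isNone) halt <|
      branch (fun v => isBit v.cur)
        (push .aux (fun v => v.cur.getD .edge) <| push .query (fun v => v.cur.getD .edge) <|
          goto fun _ => .word)
        (push .aux (fun _ => .edge) <| goto fun _ => .walk)
  | .ask => .inr fun b => if b then .yes else .no
  | .yes => .inl <|
      branch (fun v => v.fin) (load (fun v => { v with acc := true }) halt) (goto fun _ => .restore)
  | .no => .inl halt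
  | .restore => .inl <|
      pop .aux (fun v s => { v with cur := s }) <|
      branch (fun v => v.cur.isNone) (goto fun _ => .line) <|
      push .store (fun v => v.cur.getD .edge) <| goto fun _ => .restore

end ProofChecker

/-- The oracle machine that checks certificates for the minimal proof problem. -/
def proofChecker : OracleTM MPSym where
  K := ProofChecker.Stack
  Λ := ProofChecker.Lbl
  σ := ProofChecker.State
  inputStack := .store
  certStack := .cert
  queryStack := .query
  input_ne_cert := by decide
  input_ne_query := by decide
  cert_ne_query := by decide
  main := .start
  initialState := ⟨false, false, false, none⟩
  accepting v := v.acc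
  prog := ProofChecker.program

namespace ProofChecker

/-! ### One-step transition rules -/

/-- The stack contents with the given store, auxiliary stack, certificate and query. -/
def contents (a b w q : List MPSym) : Stack → List MPSym
  | .store => a
  | .aux => b
  | .cert => w
  | .query => q

/-- The configuration of the proof checker with the given stack contents. -/
def cfg (l : Option Lbl) (v : State) (a b w q : List MPSym) : proofChecker.Cfg :=
  ⟨l, v, contents a b w q⟩

@[simp] theorem contents_store (a b w q) : contents a b w q .store = a := rfl
@[simp] theorem contents_aux (a b w q) : contents a b w q .aux = b := rfl
@[simp] theorem contents_cert (a b w q) : contents a b w q .cert = w := rfl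
@[simp] theorem contents_query (a b w q) : contents a b w q .query = q := rfl

@[simp] theorem update_store (a b w q x) :
    Function.update (contents a b w q) .store x = contents x b w q := by
  funext k; cases k <;> simp [contents]
@[simp] theorem update_aux (a b w q x) :
    Function.update (contents a b w q) .aux x = contents a x w q := by
  funext k; cases k <;> simp [contents]
@[simp] theorem update_cert (a b w q x) :
    Function.update (contents a b w q) .cert x = contents a b x q := by
  funext k; cases k <;> simp [contents]
@[simp] theorem update_query (a b w q x) :
    Function.update (contents a b w q) .query x = contents a b w x := by
  funext k; cases k <;> simp [contents]

theorem exists_cfg (c : proofChecker.Cfg) : ∃ l v a b w q, c = cfg l v a b w q := by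
  obtain ⟨l, v, s⟩ := c
  refine ⟨l, v, s .store, s .aux, s .cert, s .query, ?_⟩
  unfold cfg
  congr
  funext k; cases k <;> rfl

variable (O : Set (List MPSym))

theorem step_inl {l : Lbl} {s} (h : program l = .inl s) (v a b w q) :
    proofChecker.step O (cfg (some l) v a b w q) =
      Turing.TM2.stepAux s v (contents a b w q) := by
  have h' : proofChecker.prog l = .inl s := h
  simp only [OracleTM.step, cfg, h']
  rfl

@[simp] theorem step_none (v a b w q) :
    proofChecker.step O (cfg none v a b w q) = cfg none v a b w q := rfl

theorem step_start (v a b w q) :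
    proofChecker.step O (cfg (some .start) v a b w q) =
      cfg (some .line) v (.edge :: a) b w q := by
  rw [step_inl O rfl]
  simp [Turing.TM2.stepAux, cfg]
  all_goals rfl

theorem step_line (v a b w q) :
    proofChecker.step O (cfg (some .line) v a b w q) =
      if w.head? = some .edge ∨ w.head? = some .label ∨ w.head? = some .goal then
        cfg (some .walk) ⟨false, decide (w.head? = some .goal), false, w.head?⟩ a b w.tail
          ((if w.head? = some .edge then .edge else .label) :: q)
      else cfg none ⟨false, decide (w.head? = some .goal), false, w.head?⟩ a b w.tail q := by
  rw [step_inl O rfl]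
  by_cases h : w.head? = some .edge ∨ w.head? = some .label ∨ w.head? = some .goal
  · simp [Turing.TM2.stepAux, cfg, h]
    rfl
  · simp [Turing.TM2.stepAux, cfg, h]
    rfl

theorem step_walk_nil (v b w q) :
    proofChecker.step O (cfg (some .walk) v [] b w q) =
      cfg (some .ask) { v with cur := none } [] b w q := by
  rw [step_inl O rfl]
  simp [Turing.TM2.stepAux, cfg]
  all_goals rfl

theorem step_walk_bit (v x a b w q) :
    proofChecker.step O (cfg (some .walk) v (.bit x :: a) b w q) =
      cfg (some .walk) { v with cur := some (.bit x) } a (.bit x :: b) w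
        (if v.sel then .bit x :: q else q) := by
  rw [step_inl O rfl]
  cases h : v.sel <;> simp [Turing.TM2.stepAux, cfg, isBit, copyCur, h]
  all_goals rfl

theorem step_walk_item {s : MPSym} (hs : s = .vertex ∨ s = .sentence) (v a b w q) :
    proofChecker.step O (cfg (some .walk) v (s :: a) b w q) =
      cfg (some .walk) { v with cur := some s, sel := decide (w.head? = some (.bit true)) } a
        (s :: b) w.tail (if w.head? = some (.bit true) then s :: q else q) := by
  rw [step_inl O rfl]
  by_cases h : w.head? = some (.bit true) <;> rcases hs with rfl | rfl <;>
    simp [Turing.TM2.stepAux, cfg, isBit, copyCur, h]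
  all_goals rfl

theorem step_walk_edge (v a b w q) :
    proofChecker.step O (cfg (some .walk) v (.edge :: a) b w q) =
      if v.fin then cfg (some .walk) { v with cur := some .edge, sel := false } a (.edge :: b) w q
      else cfg (some .word) { v with cur := some .edge, sel := false } a (.vertex :: b) w
        (.vertex :: q) := by
  rw [step_inl O rfl]
  cases h : v.fin <;> simp [Turing.TM2.stepAux, cfg, isBit, copyCur, h]
  all_goals rfl

theorem step_walk_goal (v a b w q) :
    proofChecker.step O (cfg (some .walk) v (.goal :: a) b w q) =
      cfg (some .walk) { v with cur := some .goal, sel := v.fin } a (.goal :: b) w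
        (if v.fin then .sentence :: q else q) := by
  rw [step_inl O rfl]
  cases h : v.fin <;> simp [Turing.TM2.stepAux, cfg, isBit, h]
  all_goals rfl

/-- Both symbols fall through to the last branch of the program. A store arising from an encoded
instance never contains `.label`, but termination is proved for arbitrary stores. -/
theorem step_walk_bound {s : MPSym} (hs : s = .bound ∨ s = .label) (v a b w q) :
    proofChecker.step O (cfg (some .walk) v (s :: a) b w q) =
      if v.fin then cfg (some .walk) { v with cur := some s, sel := false } a (.bound :: b) w q
      else cfg (if a = [] then none else some .walk) { v with cur := a.head?, sel := false } a.tail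
        (.bound :: b) w q := by
  rw [step_inl O rfl]
  cases h : v.fin <;> rcases hs with rfl | rfl <;> rcases a with _ | ⟨x, a⟩ <;>
    simp [Turing.TM2.stepAux, cfg, isBit, h]
  all_goals rfl

theorem step_word_bit (v x a b w q) :
    proofChecker.step O (cfg (some .word) v a b (.bit x :: w) q) =
      cfg (some .word) { v with cur := some (.bit x) } a (.bit x :: b) w (.bit x :: q) := by
  rw [step_inl O rfl]
  simp [Turing.TM2.stepAux, cfg, isBit]
  all_goals rfl

theorem step_word_end {s : MPSym} (hs : isBit (some s) = false) (v a b w q) :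
    proofChecker.step O (cfg (some .word) v a b (s :: w) q) =
      cfg (some .walk) { v with cur := some s } a (.edge :: b) w q := by
  rw [step_inl O rfl]
  simp [Turing.TM2.stepAux, cfg, hs]
  all_goals rfl

theorem step_word_nil (v a b q) :
    proofChecker.step O (cfg (some .word) v a b [] q) = cfg none { v with cur := none } a b [] q := by
  rw [step_inl O rfl]
  simp [Turing.TM2.stepAux, cfg]
  all_goals rfl

open Classical in
theorem step_ask (v a b w q) :
    proofChecker.step O (cfg (some .ask) v a b w q) =
      cfg (some (if q.reverse ∈ O then .yes else .no)) v a b w [] := by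
  have : proofChecker.prog .ask = .inr fun b => if b then .yes else .no := rfl
  by_cases h : q.reverse ∈ O
  · simp only [OracleTM.step, cfg, this, h, if_true]
    congr 1
    · simp [proofChecker, h]
    · exact update_query ..
  · simp only [OracleTM.step, cfg, this, h, if_false]
    congr 1
    · simp [proofChecker, h]
    · exact update_query ..

theorem step_yes (v a b w q) :
    proofChecker.step O (cfg (some .yes) v a b w q) =
      if v.fin then cfg none { v with acc := true } a b w q
      else cfg (some .restore) v a b w q := by
  rw [step_inl O rfl]
  cases h : v.fin <;> simp [Turing.TM2.stepAux, cfg, h]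
  all_goals rfl

theorem step_no (v a b w q) :
    proofChecker.step O (cfg (some .no) v a b w q) = cfg none v a b w q := by
  rw [step_inl O rfl]
  simp [Turing.TM2.stepAux, cfg]
  all_goals rfl

theorem step_restore_nil (v a w q) :
    proofChecker.step O (cfg (some .restore) v a [] w q) =
      cfg (some .line) { v with cur := none } a [] w q := by
  rw [step_inl O rfl]
  simp [Turing.TM2.stepAux, cfg]
  all_goals rfl

theorem step_restore_cons (v a s b w q) :
    proofChecker.step O (cfg (some .restore) v a (s :: b) w q) =
      cfg (some .restore) { v with cur := some s } (s :: a) b w q := by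
  rw [step_inl O rfl]
  simp [Turing.TM2.stepAux, cfg]
  all_goals rfl

end ProofChecker

namespace ProofChecker

variable (O : Set (List MPSym))

/-! ### Termination and running time -/

/-- The current label of a configuration. -/
def lbl (c : proofChecker.Cfg) : Option Lbl := c.l

@[simp] theorem lbl_cfg (l v a b w q) : lbl (cfg l v a b w q) = l := rfl

/-- The total length of store, auxiliary stack and certificate. -/
def weight (c : proofChecker.Cfg) : ℕ :=
  (c.stk Stack.store).length + (c.stk Stack.aux).length + (c.stk Stack.cert).length

/-- A function decreasing in each step of the machine after the first one, as long as the weight is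
at most `N`. -/
def potential (N : ℕ) (c : proofChecker.Cfg) : ℕ :=
  match lbl c with
  | none => 0
  | some l => (4 * N + 5) * (c.stk Stack.cert).length + match l with
    | .start => 0
    | .line => 1
    | .walk => 4 * (c.stk Stack.store).length + (c.stk Stack.aux).length + 5
    | .word => 4 * (c.stk Stack.store).length + (c.stk Stack.aux).length + 7
    | .ask => (c.stk Stack.aux).length + 4
    | .yes => (c.stk Stack.aux).length + 3
    | .no => 1
    | .restore => (c.stk Stack.aux).length + 2

@[simp] theorem cfg_stk (l v a b w q) : (cfg l v a b w q).stk = contents a b w q := rfl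

/-- Moving a symbol from store to auxiliary stack lowers the potential by 3, which covers inserting
the extra marker at the separator; the constants 5, 4, 3, 2, 1 order the phases ask, answer,
restore, next line. Only reading a certificate symbol can start a new pass, and its price `4 * N +
5` exceeds what a pass can cost when all three stacks together have length at most `N`. -/
theorem step_potential {N : ℕ} {l : Lbl} (hl : l ≠ .start) (v a b w q)
    (hN : a.length + b.length + w.length ≤ N) :
    weight (proofChecker.step O (cfg (some l) v a b w q)) ≤ N ∧
      potential N (proofChecker.step O (cfg (some l) v a b w q)) <
        potential N (cfg (some l) v a b w q) ∧
      lbl (proofChecker.step O (cfg (some l) v a b w q)) ≠ some .start := by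
  cases l with
  | start => exact absurd rfl hl
  | line =>
    rw [step_line]
    rcases w with _ | ⟨s, w⟩
    · simp [weight, potential] at hN ⊢
      omega
    · split_ifs <;> simp [weight, potential] at hN ⊢ <;> grind
  | walk =>
    rcases a with _ | ⟨s, a⟩
    · rw [step_walk_nil]
      simp [weight, potential] at hN ⊢
      omega
    -- This nonlinear monotonicity is supplied for `omega`; the certificate may already be empty, in
    -- which case its tail is no shorter.
    · have hw : (4 * N + 5) * (w.length - 1) ≤ (4 * N + 5) * w.length :=
        Nat.mul_le_mul_left _ (Nat.sub_le _ _)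
      cases s with
      | bit x => rw [step_walk_bit]; simp [weight, potential] at hN ⊢; omega
      | vertex => rw [step_walk_item O (.inl rfl)]; simp [weight, potential] at hN ⊢; omega
      | sentence => rw [step_walk_item O (.inr rfl)]; simp [weight, potential] at hN ⊢; omega
      | edge =>
        rw [step_walk_edge]; split_ifs <;> simp [weight, potential] at hN ⊢ <;> omega
      | goal => rw [step_walk_goal]; simp [weight, potential] at hN ⊢; omega
      | bound =>
        rw [step_walk_bound O (.inl rfl)]
        split_ifs <;> simp [weight, potential] at hN ⊢ <;> omega
      | label =>
        rw [step_walk_bound O (.inr rfl)]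
        split_ifs <;> simp [weight, potential] at hN ⊢ <;> omega
  | word =>
    rcases w with _ | ⟨s, w⟩
    · rw [step_word_nil]
      simp [weight, potential] at hN ⊢
      omega
    · by_cases hs : isBit (some s) = true
      · obtain ⟨x, rfl⟩ : ∃ x, s = .bit x := by cases s <;> simp_all [isBit]
        rw [step_word_bit]
        simp [weight, potential, Nat.mul_add] at hN ⊢
        omega
      · rw [step_word_end O (by simpa using hs)]
        simp [weight, potential, Nat.mul_add] at hN ⊢
        omega
  | ask =>
    rw [step_ask]
    split_ifs <;> simp [weight, potential] at hN ⊢ <;> omega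
  | yes =>
    rw [step_yes]
    split_ifs <;> simp [weight, potential] at hN ⊢ <;> omega
  | no =>
    rw [step_no]
    simp [weight, potential] at hN ⊢; omega
  | restore =>
    rcases b with _ | ⟨s, b⟩
    · rw [step_restore_nil]
      simp [weight, potential] at hN ⊢; omega
    · rw [step_restore_cons]
      simp [weight, potential] at hN ⊢; omega

theorem halts_of_potential {N : ℕ} (t : ℕ) (c : proofChecker.Cfg) (hl : lbl c ≠ some .start)
    (hN : weight c ≤ N) (ht : potential N c ≤ t) : ((proofChecker.step O)^[t] c).l = none := by
  induction t generalizing c with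
  | zero =>
    obtain ⟨l, v, a, b, w, q, rfl⟩ := exists_cfg c
    rcases l with _ | l
    · rfl
    · have := (step_potential O (N := N) (l := l) (by rintro rfl; exact hl rfl) v a b w q hN).2.1
      omega
  | succ t ih =>
    obtain ⟨l, v, a, b, w, q, rfl⟩ := exists_cfg c
    rw [Function.iterate_succ_apply]
    rcases l with _ | l
    · rw [step_none]
      exact ih _ (by simp) hN (by simp [potential])
    · obtain ⟨h1, h2, h3⟩ :=
        step_potential O (N := N) (l := l) (by rintro rfl; exact hl rfl) v a b w q hN
      exact ih _ h3 h1 (by omega)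

theorem initCfg_eq (x w : List MPSym) :
    proofChecker.initCfg x w = cfg (some .start) ⟨false, false, false, none⟩ x [] w [] := by
  have : ∀ (s t : Stack → List MPSym), s = t →
    (⟨some .start, ⟨false, false, false, none⟩, s⟩ : proofChecker.Cfg) =
      ⟨some .start, ⟨false, false, false, none⟩, t⟩ := by rintro s _ rfl; rfl
  apply this
  funext k
  cases k <;> rfl

/-- The extra `1` in the total length is the separator pushed at the start; the final `2` is that
first step plus the potential of the line label. -/
theorem haltsWithin (x w : List MPSym) {t : ℕ}
    (ht : (4 * (x.length + 1 + w.length) + 5) * w.length + 2 ≤ t) :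
    proofChecker.HaltsWithin O x w t := by
  obtain ⟨t, rfl⟩ : ∃ s, t = s + 1 := ⟨t - 1, by omega⟩
  unfold OracleTM.HaltsWithin OracleTM.run
  rw [initCfg_eq, Function.iterate_succ_apply, step_start]
  refine halts_of_potential O (N := x.length + 1 + w.length) t _ (by simp) ?_ ?_
  · simp [weight]
  · simp [potential]; omega

/-! ### The behaviour of the machine -/

/-- Some number of steps leads from the first to the second configuration. -/
def Reaches (c c' : proofChecker.Cfg) : Prop := ∃ t, (proofChecker.step O)^[t] c = c'

variable {O}

theorem Reaches.refl (c) : Reaches O c c := ⟨0, rfl⟩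

theorem Reaches.trans {c c' c''} (h : Reaches O c c') (h' : Reaches O c' c'') :
    Reaches O c c'' := by
  obtain ⟨t, rfl⟩ := h
  obtain ⟨s, rfl⟩ := h'
  exact ⟨s + t, Function.iterate_add_apply ..⟩

theorem Reaches.head {c c' c''} (h : proofChecker.step O c = c') (h' : Reaches O c' c'') :
    Reaches O c c'' := Reaches.trans ⟨1, h⟩ h'

/-- The machine eventually halts in an accepting state. -/
def Accepts (O : Set (List MPSym)) (c : proofChecker.Cfg) : Prop :=
  ∃ t, ((proofChecker.step O)^[t] c).l = none ∧
    proofChecker.accepting ((proofChecker.step O)^[t] c).var = true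

theorem iterate_step_of_halted {c : proofChecker.Cfg} (h : c.l = none) (t : ℕ) :
    (proofChecker.step O)^[t] c = c := by
  apply Function.iterate_fixed
  simp only [OracleTM.step, h]

theorem accepts_halted {c : proofChecker.Cfg} (h : c.l = none) :
    Accepts O c ↔ proofChecker.accepting c.var = true := by
  simp [Accepts, iterate_step_of_halted h, h]

/-- The machine is deterministic and halted configurations are fixed points, so acceptance can be
transported along a run in both directions without counting steps. -/
theorem Reaches.accepts_iff {c c'} (h : Reaches O c c') : Accepts O c ↔ Accepts O c' := by
  obtain ⟨s, rfl⟩ := h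
  constructor
  · rintro ⟨t, h1, h2⟩
    refine ⟨t, ?_⟩
    rw [← Function.iterate_add_apply, Nat.add_comm, Function.iterate_add_apply,
      iterate_step_of_halted h1]
    exact ⟨h1, h2⟩
  · rintro ⟨t, h1, h2⟩
    exact ⟨t + s, by rwa [Function.iterate_add_apply], by rwa [Function.iterate_add_apply]⟩

theorem acceptsWithin_iff {x w : List MPSym} {t : ℕ} (h : proofChecker.HaltsWithin O x w t) :
    proofChecker.AcceptsWithin O x w t ↔
      Accepts O (cfg (some .start) ⟨false, false, false, none⟩ x [] w []) := by
  rw [← initCfg_eq, Reaches.accepts_iff (c' := proofChecker.run O x w t) ⟨t, rfl⟩, accepts_halted h]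
  exact and_iff_right h

theorem accepts_iff_of_step {c c'} (h : proofChecker.step O c = c') :
    Accepts O c ↔ Accepts O c' := Reaches.accepts_iff ⟨1, h⟩

/-! ### Passing over the store -/

/-- The word of a list of items, each marked by `m`. -/
def items (m : MPSym) (ds : List (List Bool)) : List MPSym :=
  ds.flatMap fun d => m :: d.map .bit

/-- The items selected by the certificate. -/
def pick : List (List Bool) → List MPSym → List (List Bool)
  | [], _ => []
  | d :: ds, w => if w.head? = some (.bit true) then d :: pick ds w.tail else pick ds w.tail

theorem reaches_walk_bits (ds : List Bool) (v a b w q) :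
    ∃ v', v'.sel = v.sel ∧ v'.fin = v.fin ∧ v'.acc = v.acc ∧
    Reaches O (cfg (some .walk) v (ds.map .bit ++ a) b w q)
      (cfg (some .walk) v' a ((ds.map .bit).reverse ++ b) w
        (if v.sel then (ds.map .bit).reverse ++ q else q)) := by
  induction ds generalizing v b q with
  | nil => exact ⟨v, rfl, rfl, rfl, by simpa using Reaches.refl _⟩
  | cons x ds ih =>
    obtain ⟨v', h1, h2, h3, h⟩ := ih { v with cur := some (.bit x) } (.bit x :: b)
      (if v.sel then .bit x :: q else q)
    refine ⟨v', h1, h2, h3, Reaches.head (step_walk_bit ..) ?_⟩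
    cases hv : v.sel <;> simpa [hv] using h

/-- Each marker consumes one certificate symbol deciding whether its word is copied. An exhausted
certificate selects nothing. Stacks reverse what is pushed, hence the reversals. -/
theorem reaches_walk_items {m : MPSym} (hm : m = .vertex ∨ m = .sentence)
    (ds : List (List Bool)) (v a b w q) :
    ∃ v', v'.fin = v.fin ∧ v'.acc = v.acc ∧
    Reaches O (cfg (some .walk) v (items m ds ++ a) b w q)
      (cfg (some .walk) v' a ((items m ds).reverse ++ b) (w.drop ds.length)
        ((items m (pick ds w)).reverse ++ q)) := by
  induction ds generalizing v b w q with
  | nil => exact ⟨v, rfl, rfl, by simpa [items, pick] using Reaches.refl _⟩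
  | cons d ds ih =>
    obtain ⟨v₁, h1, h2, h3, h⟩ := reaches_walk_bits (O := O) d
      { v with cur := some m, sel := decide (w.head? = some (.bit true)) } (items m ds ++ a)
        (m :: b) w.tail (if w.head? = some (.bit true) then m :: q else q)
    obtain ⟨v₂, h4, h5, h'⟩ := ih v₁ ((d.map .bit).reverse ++ m :: b) w.tail
      (if w.head? = some (.bit true) then (d.map .bit).reverse ++ m :: q else q)
    refine ⟨v₂, h4.trans h2, h5.trans h3, ?_⟩
    have e : items m (d :: ds) ++ a = m :: (d.map .bit ++ (items m ds ++ a)) := by simp [items]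
    rw [e]
    refine Reaches.head (step_walk_item O hm ..) (h.trans ?_)
    convert h' using 2
    · by_cases h : w.head? = some (.bit true) <;> simp [h]
    · simp [items]
    · simp
    · by_cases h : w.head? = some (.bit true) <;> simp [h, pick, items]

theorem reaches_word (ds : List Bool) (v a b w q) :
    ∃ v', v'.sel = v.sel ∧ v'.fin = v.fin ∧ v'.acc = v.acc ∧
    Reaches O (cfg (some .word) v a b (ds.map .bit ++ w) q)
      (cfg (some .word) v' a ((ds.map .bit).reverse ++ b) w ((ds.map .bit).reverse ++ q)) := by
  induction ds generalizing v b q with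
  | nil => exact ⟨v, rfl, rfl, rfl, by simpa using Reaches.refl _⟩
  | cons x ds ih =>
    obtain ⟨v', h1, h2, h3, h⟩ := ih { v with cur := some (.bit x) } (.bit x :: b) (.bit x :: q)
    exact ⟨v', h1, h2, h3, Reaches.head (step_word_bit ..) (by simpa using h)⟩

theorem reaches_restore (v a b w q) :
    ∃ v', Reaches O (cfg (some .restore) v a b w q)
      (cfg (some .line) v' (b.reverse ++ a) [] w q) := by
  induction b generalizing v a with
  | nil => exact ⟨_, Reaches.head (step_restore_nil ..) (Reaches.refl _)⟩
  | cons s b ih =>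
    obtain ⟨v', h⟩ := ih { v with cur := some s } (s :: a)
    exact ⟨v', Reaches.head (step_restore_cons ..) (by simpa using h)⟩

/-- The store of the machine after the vertices with index words `D` have been derived from the
theory with words `T`, where `g` is the word of the goal and `n` vertices remain. -/
def storeWord (D T : List (List Bool)) (g : List Bool) (n : ℕ) : List MPSym :=
  items .vertex D ++ .edge :: (items .sentence T ++ .goal :: (g.map .bit ++
    .bound :: List.replicate n (.bit true)))

/-- The configuration before reading a line of the certificate. -/
def lineCfg (D T : List (List Bool)) (g : List Bool) (n : ℕ) (w : List MPSym) :
    proofChecker.Cfg :=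
  cfg (some .line) ⟨false, false, false, none⟩ (storeWord D T g n) [] w []

/-- Reading the head of a line overwrites the whole internal state, so every line may be assumed to
start from the default one. -/
theorem accepts_line_iff (v v' a b w q) :
    Accepts O (cfg (some .line) v a b w q) ↔ Accepts O (cfg (some .line) v' a b w q) := by
  rw [accepts_iff_of_step (step_line ..), accepts_iff_of_step (step_line O v' ..)]

theorem reaches_walk_unary (n : ℕ) (v : State) (hv : v.sel = false) (b w q) :
    ∃ v', v'.fin = v.fin ∧ v'.acc = v.acc ∧
    Reaches O (cfg (some .walk) v (List.replicate n (.bit true)) b w q)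
      (cfg (some .ask) v' [] (List.replicate n (.bit true) ++ b) w q) := by
  obtain ⟨v', h1, h2, h3, h⟩ := reaches_walk_bits (O := O) (List.replicate n true) v [] b w q
  refine ⟨{ v' with cur := none }, h2, h3, ?_⟩
  have := h.trans (Reaches.head (step_walk_nil ..) (Reaches.refl _))
  simpa [hv] using this

end ProofChecker

namespace ProofChecker

variable {O : Set (List MPSym)}

/-! ### Acceptance line by line -/

theorem not_accepts_halted {v a b w q} (hv : v.acc = false) :
    ¬ Accepts O (cfg none v a b w q) := by
  rw [accepts_halted rfl]
  change ¬ v.acc = true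
  simp [hv]

theorem accepts_ask_iff {v : State} (hv : v.acc = false) (a b w q) :
    Accepts O (cfg (some .ask) v a b w q) ↔
      q.reverse ∈ O ∧ (v.fin = true ∨
        Accepts O (cfg (some .line) ⟨false, false, false, none⟩ (b.reverse ++ a) [] w [])) := by
  rw [accepts_iff_of_step (step_ask ..)]
  by_cases hq : q.reverse ∈ O
  · simp only [hq, if_true, true_and]
    rw [accepts_iff_of_step (step_yes ..)]
    cases hf : v.fin
    · obtain ⟨v', h⟩ := reaches_restore (O := O) v a b w []
      simp only [Bool.false_eq_true, if_false, false_or]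
      rw [h.accepts_iff, accepts_line_iff]
    · simp only [if_true, true_or, iff_true]
      rw [accepts_halted rfl]
      rfl
  · simp only [hq, if_false, false_and, iff_false]
    rw [accepts_iff_of_step (step_no ..)]
    exact not_accepts_halted hv

theorem not_accepts_lineCfg {D T g n w}
    (h : ¬ (w.head? = some .edge ∨ w.head? = some .label ∨ w.head? = some .goal)) :
    ¬ Accepts O (lineCfg D T g n w) := by
  rw [lineCfg, accepts_iff_of_step (step_line ..), if_neg h]
  exact not_accepts_halted rfl

/-- The final pass leaves separator and bound alone and always copies the goal; a positive answer
accepts at once, so nothing further is read from the certificate. -/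
theorem accepts_lineCfg_goal (D T g n w) :
    Accepts O (lineCfg D T g n (.goal :: w)) ↔
      .label :: (items .vertex (pick D w) ++ (items .sentence (pick T (w.drop D.length)) ++
        .sentence :: g.map .bit)) ∈ O := by
  rw [lineCfg, accepts_iff_of_step (step_line ..)]
  simp only [List.head?_cons, reduceCtorEq, or_true, if_true, Option.some.injEq, if_false,
    decide_true, List.tail_cons]
  obtain ⟨v₁, hf, ha, h⟩ := reaches_walk_items (O := O) (.inl rfl) D
    ⟨false, true, false, some .goal⟩
    (.edge :: (items .sentence T ++ .goal :: (g.map .bit ++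
      .bound :: List.replicate n (.bit true)))) [] w [.label]
  simp only at hf ha
  rw [storeWord, h.accepts_iff, accepts_iff_of_step (step_walk_edge ..)]
  simp only [hf, if_true]
  obtain ⟨v₂, hf₂, ha₂, h₂⟩ := reaches_walk_items (O := O) (.inr rfl) T
    { v₁ with cur := some .edge, sel := false } (.goal :: (g.map .bit ++
      .bound :: List.replicate n (.bit true))) (.edge :: ((items .vertex D).reverse ++ []))
      (w.drop D.length) ((items .vertex (pick D w)).reverse ++ [.label])
  simp only at hf₂ ha₂
  simp only [hf] at h₂
  rw [h₂.accepts_iff, accepts_iff_of_step (step_walk_goal ..)]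
  simp only [hf₂, hf, if_true]
  obtain ⟨v₃, hs₃, hf₃, ha₃, h₃⟩ := reaches_walk_bits (O := O) g
    { v₂ with cur := some .goal, sel := true } (.bound :: List.replicate n (.bit true))
    (.goal :: ((items .sentence T).reverse ++ .edge :: ((items .vertex D).reverse ++ [])))
    ((w.drop D.length).drop T.length) (.sentence ::
      ((items .sentence (pick T (w.drop D.length))).reverse ++
        ((items .vertex (pick D w)).reverse ++ [.label])))
  simp only [hf₂, hf] at h₃ hf₃ ha₃
  rw [h₃.accepts_iff, accepts_iff_of_step (step_walk_bound O (.inl rfl) ..)]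
  simp only [hf₃, if_true]
  obtain ⟨v₄, hf₄, ha₄, h₄⟩ := reaches_walk_unary (O := O) n
    { v₃ with cur := some .bound, sel := false } rfl
    (.bound :: ((g.map .bit).reverse ++ (.goal :: ((items .sentence T).reverse ++
      .edge :: ((items .vertex D).reverse ++ [])))))
    ((w.drop D.length).drop T.length) ((g.map .bit).reverse ++ (.sentence ::
      ((items .sentence (pick T (w.drop D.length))).reverse ++
        ((items .vertex (pick D w)).reverse ++ [.label]))))
  simp only [hf₃] at h₄ hf₄ ha₄
  rw [h₄.accepts_iff, accepts_ask_iff (ha₄.trans (ha₃.trans (ha₂.trans ha)))]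
  simp [hf₄]

/-- Follows one full pass: selection over `D`, the new index `d` up to its terminator `s`, selection
over `T`, skipping the goal, paying one unit, query, restoration. The same pass serves hyperedge and
axiom lines, which differ only in the head `p`. -/
theorem accepts_lineCfg_step {p s : MPSym} (hp : p = .edge ∨ p = .label)
    (hs : isBit (some s) = false) {D T g n w w'} {d : List Bool}
    (hw : w.drop D.length = d.map .bit ++ s :: w') :
    Accepts O (lineCfg D T g n (p :: w)) ↔
      ∃ m, n = m + 1 ∧ p :: (items .vertex (pick D w) ++ (items .vertex [d] ++
        items .sentence (pick T w'))) ∈ O ∧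
        Accepts O (lineCfg (D ++ [d]) T g m (w'.drop T.length)) := by
  rw [lineCfg, accepts_iff_of_step (step_line ..)]
  have h1 : (if p = .edge then MPSym.edge else .label) = p := by rcases hp with rfl | rfl <;> rfl
  have h2 : p ≠ .goal := by rcases hp with rfl | rfl <;> decide
  simp only [List.head?_cons, Option.some.injEq, h1, h2, or_false, hp, decide_false, if_true,
    List.tail_cons]
  obtain ⟨v₁, hf, ha, h⟩ := reaches_walk_items (O := O) (.inl rfl) D
    ⟨false, false, false, some p⟩
    (.edge :: (items .sentence T ++ .goal :: (g.map .bit ++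
      .bound :: List.replicate n (.bit true)))) [] w [p]
  simp only at hf ha
  rw [storeWord, h.accepts_iff, accepts_iff_of_step (step_walk_edge ..), hw]
  simp only [hf, if_false, Bool.false_eq_true]
  obtain ⟨v₅, hs₅, hf₅, ha₅, h₅⟩ := reaches_word (O := O) d
    { v₁ with cur := some .edge, sel := false } (items .sentence T ++ .goal :: (g.map .bit ++
      .bound :: List.replicate n (.bit true))) (.vertex :: ((items .vertex D).reverse ++ []))
      (s :: w') (.vertex :: ((items .vertex (pick D w)).reverse ++ [p]))
  simp only [hf] at hf₅ ha₅ h₅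
  rw [h₅.accepts_iff, accepts_iff_of_step (step_word_end O hs ..)]
  simp only [hf₅]
  obtain ⟨v₂, hf₂, ha₂, h₂⟩ := reaches_walk_items (O := O) (.inr rfl) T
    { v₅ with cur := some s } (.goal :: (g.map .bit ++
      .bound :: List.replicate n (.bit true))) (.edge :: ((d.map .bit).reverse ++
        .vertex :: ((items .vertex D).reverse ++ []))) w'
        ((d.map .bit).reverse ++ .vertex :: ((items .vertex (pick D w)).reverse ++ [p]))
  simp only [hf₅] at hf₂ ha₂ h₂
  rw [h₂.accepts_iff, accepts_iff_of_step (step_walk_goal ..)]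
  simp only [hf₂, Bool.false_eq_true, if_false]
  obtain ⟨v₃, hs₃, hf₃, ha₃, h₃⟩ := reaches_walk_bits (O := O) g
    { v₂ with cur := some .goal, sel := false } (.bound :: List.replicate n (.bit true))
    (.goal :: ((items .sentence T).reverse ++ (.edge :: ((d.map .bit).reverse ++
        .vertex :: ((items .vertex D).reverse ++ [])))))
    (w'.drop T.length) ((items .sentence (pick T w')).reverse ++
        ((d.map .bit).reverse ++ .vertex :: ((items .vertex (pick D w)).reverse ++ [p])))
  simp only [hf₂, Bool.false_eq_true, if_false] at h₃ hf₃ ha₃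
  rw [h₃.accepts_iff, accepts_iff_of_step (step_walk_bound O (.inl rfl) ..)]
  simp only [hf₃, if_false, Bool.false_eq_true]
  have hacc : v₃.acc = false := ha₃.trans (ha₂.trans (ha₅.trans ha))
  rcases n with _ | m
  -- With no unit left the machine rejects before asking the oracle.
  · simp only [List.replicate_zero, if_true]
    simp only [Nat.right_eq_add, Nat.succ_ne_zero, false_and, exists_false, iff_false]
    exact not_accepts_halted hacc
  simp only [List.replicate_succ, reduceCtorEq, if_false, List.head?_cons, List.tail_cons]
  obtain ⟨v₄, hf₄, ha₄, h₄⟩ := reaches_walk_unary (O := O) m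
    { v₃ with cur := some (.bit true), sel := false } rfl
    (.bound :: ((g.map .bit).reverse ++ (.goal :: ((items .sentence T).reverse ++
      (.edge :: ((d.map .bit).reverse ++ .vertex :: ((items .vertex D).reverse ++ [])))))))
    (w'.drop T.length) ((items .sentence (pick T w')).reverse ++
        ((d.map .bit).reverse ++ .vertex :: ((items .vertex (pick D w)).reverse ++ [p])))
  simp only [hf₃] at h₄ hf₄ ha₄
  rw [h₄.accepts_iff, accepts_ask_iff (ha₄.trans hacc)]
  simp [hf₄, lineCfg, storeWord, items]

theorem not_accepts_lineCfg_of_unterminated {p : MPSym} (hp : p = .edge ∨ p = .label)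
    {D T g n w} {d : List Bool} (hw : w.drop D.length = d.map .bit) :
    ¬ Accepts O (lineCfg D T g n (p :: w)) := by
  rw [lineCfg, accepts_iff_of_step (step_line ..)]
  have h1 : (if p = .edge then MPSym.edge else .label) = p := by rcases hp with rfl | rfl <;> rfl
  have h2 : p ≠ .goal := by rcases hp with rfl | rfl <;> decide
  simp only [List.head?_cons, Option.some.injEq, h1, h2, or_false, hp, decide_false, if_true,
    List.tail_cons]
  obtain ⟨v₁, hf, ha, h⟩ := reaches_walk_items (O := O) (.inl rfl) D
    ⟨false, false, false, some p⟩
    (.edge :: (items .sentence T ++ .goal :: (g.map .bit ++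
      .bound :: List.replicate n (.bit true)))) [] w [p]
  simp only at hf ha
  rw [storeWord, h.accepts_iff, accepts_iff_of_step (step_walk_edge ..), hw]
  simp only [hf, if_false, Bool.false_eq_true]
  obtain ⟨v₅, hs₅, hf₅, ha₅, h₅⟩ := reaches_word (O := O) d
    { v₁ with cur := some .edge, sel := false } (items .sentence T ++ .goal :: (g.map .bit ++
      .bound :: List.replicate n (.bit true))) (.vertex :: ((items .vertex D).reverse ++ []))
      [] (.vertex :: ((items .vertex (pick D w)).reverse ++ [p]))
  simp only [hf, List.append_nil] at hf₅ ha₅ h₅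
  rw [List.append_nil, h₅.accepts_iff, accepts_iff_of_step (step_word_nil ..)]
  exact not_accepts_halted (ha₅.trans ha)

/-- Cuts at the first symbol that is not a bit, so that the terminated and unterminated cases cover
every ordinary line. -/
theorem exists_bits_append (w : List MPSym) : ∃ d : List Bool, w = d.map .bit ∨
    ∃ s w', isBit (some s) = false ∧ w = d.map .bit ++ s :: w' := by
  induction w with
  | nil => exact ⟨[], .inl rfl⟩
  | cons s w ih =>
    by_cases hs : isBit (some s) = true
    · obtain ⟨x, rfl⟩ : ∃ x, s = .bit x := by cases s <;> simp_all [isBit]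
      obtain ⟨d, rfl | ⟨s, w', hs', rfl⟩⟩ := ih
      · exact ⟨x :: d, .inl rfl⟩
      · exact ⟨x :: d, .inr ⟨s, w', hs', rfl⟩⟩
    · exact ⟨[], .inr ⟨s, w, by simpa using hs, rfl⟩⟩

/-- One line of the certificate is checked. -/
theorem accepts_lineCfg_cases {D T g n w} (h : Accepts O (lineCfg D T g n w)) :
    (∃ w', .label :: (items .vertex (pick D w') ++ (items .sentence (pick T (w'.drop D.length)) ++
        .sentence :: g.map .bit)) ∈ O) ∨
    ∃ p w₁ w₂ d m, (p = MPSym.edge ∨ p = .label) ∧ n = m + 1 ∧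
      p :: (items .vertex (pick D w₁) ++ (items .vertex [d] ++ items .sentence (pick T w₂))) ∈ O ∧
      Accepts O (lineCfg (D ++ [d]) T g m (w₂.drop T.length)) := by
  rcases w with _ | ⟨p, w⟩
  · exact absurd h (not_accepts_lineCfg (by simp))
  · by_cases hp : p = .edge ∨ p = .label
    · obtain ⟨d, hd | ⟨s, w', hs, hd⟩⟩ := exists_bits_append (w.drop D.length)
      · exact absurd h (not_accepts_lineCfg_of_unterminated hp hd)
      · obtain ⟨m, h1, h2, h3⟩ := (accepts_lineCfg_step hp hs hd).1 h
        exact .inr ⟨p, w, w', d, m, hp, h1, h2, h3⟩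
    · by_cases hg : p = .goal
      · subst hg
        exact .inl ⟨w, (accepts_lineCfg_goal ..).1 h⟩
      · exact absurd h (not_accepts_lineCfg (by simp; tauto))

theorem acceptsWithin_iff_lineCfg {T : List (List Bool)} {g : List Bool} {n : ℕ} {w : List MPSym}
    {x : List MPSym} {t : ℕ} (hx : .edge :: x = storeWord [] T g n)
    (h : proofChecker.HaltsWithin O x w t) :
    proofChecker.AcceptsWithin O x w t ↔ Accepts O (lineCfg [] T g n w) := by
  rw [acceptsWithin_iff h, accepts_iff_of_step (step_start ..), hx]
  rfl

/-! ### Selections and unique readability -/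

/-- The part of a certificate that selects the given sublist. -/
theorem exists_pick {D D' : List (List Bool)} (h : D'.Sublist D) :
    ∃ m : List MPSym, m.length = D.length ∧ ∀ w, pick D (m ++ w) = D' := by
  induction h with
  | slnil => exact ⟨[], rfl, fun _ => rfl⟩
  | cons a _ ih =>
    obtain ⟨m, h1, h2⟩ := ih
    exact ⟨.bit false :: m, by simp [h1], fun w => by simp [pick, h2]⟩
  | cons_cons a _ ih =>
    obtain ⟨m, h1, h2⟩ := ih
    exact ⟨.bit true :: m, by simp [h1], fun w => by simp [pick, h2]⟩

theorem pick_subset (D : List (List Bool)) (w : List MPSym) : pick D w ⊆ D := by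
  induction D generalizing w with
  | nil => simp [pick]
  | cons d D ih =>
    unfold pick
    split_ifs
    · exact List.cons_subset_cons _ (ih _)
    · exact List.subset_cons_of_subset _ (ih _)

theorem items_eq_flatMap (m : Bool → MPSym) (b : Bool) (ds : List (List Bool)) :
    items (m b) ds = (ds.map (Prod.mk b)).flatMap fun d => m d.1 :: d.2.map .bit := by
  simp [items, List.flatMap_map]

theorem map_bit_append_inj {d d' : List Bool} {u u' : List MPSym}
    (hu : isBit u.head? = false) (hu' : isBit u'.head? = false)
    (h : d.map .bit ++ u = d'.map .bit ++ u') : d = d' ∧ u = u' := by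
  induction d generalizing d' with
  | nil =>
    rcases d' with _ | ⟨x, d'⟩
    · exact ⟨rfl, h⟩
    · simp only [List.map_nil, List.nil_append] at h
      subst h; simp [isBit] at hu
  | cons x d ih =>
    rcases d' with _ | ⟨y, d'⟩
    · simp only [List.map_nil, List.nil_append] at h
      subst h; simp [isBit] at hu'
    · simp only [List.map_cons, List.cons_append, List.cons.injEq, MPSym.bit.injEq] at h
      obtain ⟨h1, h2⟩ := ih h.2
      exact ⟨by rw [h.1, h1], h2⟩

/-- Marked words can be read off their concatenation. -/
theorem flatMap_marked_injective {m : Bool → MPSym} (hm : Function.Injective m)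
    (hb : ∀ b, isBit (some (m b)) = false) :
    Function.Injective fun l : List (Bool × List Bool) => l.flatMap fun d => m d.1 :: d.2.map .bit := by
  have hd : ∀ l : List (Bool × List Bool),
      isBit (l.flatMap fun d => m d.1 :: d.2.map .bit).head? = false := by
    rintro (_ | ⟨d, l⟩)
    · rfl
    · simp [hb]
  intro l l' h
  induction l generalizing l' with
  | nil =>
    rcases l' with _ | ⟨d', l'⟩
    · rfl
    · simp at h
  | cons d l ih =>
    rcases l' with _ | ⟨d', l'⟩
    · simp at h
    · simp only [List.flatMap_cons, List.cons_append, List.cons.injEq] at h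
      obtain ⟨h1, h2⟩ := map_bit_append_inj (hd l) (hd l') h.2
      rw [ih h2, Prod.ext (hm h.1) h1]

/-- The marker of vertices and of sentences. -/
def marker : Bool → MPSym
  | true => .vertex
  | false => .sentence

theorem items_inj {l l' : List (Bool × List Bool)}
    (h : (l.flatMap fun d => marker d.1 :: d.2.map MPSym.bit) =
      l'.flatMap fun d => marker d.1 :: d.2.map .bit) : l = l' :=
  flatMap_marked_injective (m := marker) (by decide) (by decide) h

end ProofChecker

/-! ### Derivations in a hypergraph -/

namespace LHypergraph

variable {U : Type w} {S : Type u}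

/-- Lists of vertices (the latest first) that can be derived one after the other, each by being
labelled by an element of `T` or by means of a hyperedge from vertices derived before. -/
inductive Derivation (H : LHypergraph U S) (T : Finset S) : List U → Prop
  | nil : Derivation H T []
  | leaf {l : List U} {x : U} : Derivation H T l → x ∈ H.V → H.label x ∈ T → Derivation H T (x :: l)
  | edge {l : List U} {A : Finset U} {x : U} : Derivation H T l → (A, x) ∈ H.E → (∀ y ∈ A, y ∈ l) →
      Derivation H T (x :: l)

theorem Derivation.mem_V {H : LHypergraph U S} {T : Finset S} {l : List U}
    (hl : H.Derivation T l) : ∀ x ∈ l, x ∈ H.V := by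
  induction hl with
  | nil => simp
  | leaf _ hx _ ih => simpa [hx] using ih
  | edge _ he _ ih => simpa [(H.edge_mem _ he).2] using ih

open Classical in
/-- The number of vertices from which there is a path of positive length to `x`. -/
noncomputable def height (H : LHypergraph U S) (x : U) : ℕ :=
  (H.V.filter fun y => Relation.TransGen H.Step y x).card

theorem Acyclic.height_lt {H : LHypergraph U S} (hH : H.Acyclic) {x y : U} (h : H.Step x y) :
    H.height x < H.height y := by
  classical
  have hx : x ∈ H.V := by
    obtain ⟨e, he, hx, -⟩ := h
    exact (H.edge_mem e he).1 hx
  refine Finset.card_lt_card ⟨fun z hz => ?_, fun hsub => ?_⟩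
  · simp only [Finset.mem_filter] at hz ⊢
    exact ⟨hz.1, hz.2.tail h⟩
  · have := hsub (Finset.mem_filter.2 ⟨hx, Relation.TransGen.single h⟩)
    exact hH x (Finset.mem_filter.1 this).2

/-- The images of the vertices of an acyclic hypergraph with leaves labelled in `T` can be derived
in some order. -/
theorem exists_derivation_of_isHom {U' : Type*} {P : LHypergraph U' S} {H : LHypergraph U S}
    {T : Finset S} {h : U' → U} (hh : P.IsHom H h) (hP : P.Acyclic)
    (hT : ∀ x, P.IsLeaf x → P.label x ∈ T) :
    ∃ l, H.Derivation T l ∧ l.length = P.V.card ∧ ∀ x ∈ P.V, h x ∈ l := by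
  classical
  -- The induction runs over sets closed under passing to vertices of smaller height, adding a
  -- vertex of maximal height last; the sources of a hyperedge into it are strictly lower, hence
  -- already listed. The list records one entry per vertex of `P`, so images may repeat.
  have key : ∀ s : Finset U', s ⊆ P.V →
      (∀ x ∈ s, ∀ y ∈ P.V, P.height y < P.height x → y ∈ s) →
      ∃ l, H.Derivation T l ∧ l.length = s.card ∧ ∀ x ∈ s, h x ∈ l := by
    intro s
    induction s using Finset.induction_on_max_value P.height with
    | empty => exact fun _ _ => ⟨[], .nil, rfl, by simp⟩
    | insert a s ha hmax ih =>
      intro hs hcl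
      obtain ⟨l, hl, hlen, hmem⟩ := ih ((Finset.subset_insert _ _).trans hs) (by
        intro x hx y hy hyx
        rcases Finset.mem_insert.1 (hcl x (Finset.mem_insert_of_mem hx) y hy hyx) with rfl | h
        · exact absurd (hmax x hx) (by omega)
        · exact h)
      have haV : a ∈ P.V := hs (Finset.mem_insert_self _ _)
      refine ⟨h a :: l, ?_, by simp [hlen, ha], by simpa using fun x hx => .inr (hmem x hx)⟩
      by_cases hleaf : P.IsLeaf a
      · exact hl.leaf (hh.1 a haV) (by rw [hh.2.2 a haV]; exact hT a hleaf)
      · obtain ⟨⟨A, b⟩, he, rfl⟩ : ∃ e ∈ P.E, e.2 = a := by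
          by_contra! hne
          exact hleaf ⟨haV, hne⟩
        refine hl.edge (hh.2.1 _ he) fun y hy => ?_
        obtain ⟨x, hx, rfl⟩ := Finset.mem_image.1 hy
        have hlt := hP.height_lt ⟨_, he, hx, rfl⟩
        rcases Finset.mem_insert.1 (hcl _ (Finset.mem_insert_self _ _) x
          ((P.edge_mem _ he).1 hx) hlt) with rfl | h
        · exact absurd hlt (lt_irrefl _)
        · exact hmem x h
  exact key P.V subset_rfl fun _ _ y hy _ => hy

open Classical in
/-- The positions in a derivation carry a hyperedge relation. -/
theorem Derivation.exists_seq {H : LHypergraph U S} {T : Finset S} {l : List U}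
    (hl : H.Derivation T l) (x₀ : U) : ∃ d : ℕ → U, (∀ x ∈ l, ∃ k < l.length, d k = x) ∧
      ∀ k < l.length, d k ∈ H.V ∧ (H.label (d k) ∈ T ∨
        ∃ A : Finset ℕ, (∀ j ∈ A, j < k) ∧ (A.image d, d k) ∈ H.E) := by
  have upd : ∀ (d : ℕ → U) (n k : ℕ) (x : U), k < n → Function.update d n x k = d k :=
    fun d n k x hk => Function.update_of_ne hk.ne _ _
  have ext : ∀ {l : List U} {d : ℕ → U} (x : U), (∀ x ∈ l, ∃ k < l.length, d k = x) →
      (∀ k < l.length, d k ∈ H.V ∧ (H.label (d k) ∈ T ∨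
        ∃ A : Finset ℕ, (∀ j ∈ A, j < k) ∧ (A.image d, d k) ∈ H.E)) →
      (x ∈ H.V ∧ (H.label x ∈ T ∨
        ∃ A : Finset ℕ, (∀ j ∈ A, j < l.length) ∧ (A.image d, x) ∈ H.E)) →
      ∃ d : ℕ → U, (∀ y ∈ x :: l, ∃ k < (x :: l).length, d k = y) ∧
      ∀ k < (x :: l).length, d k ∈ H.V ∧ (H.label (d k) ∈ T ∨
        ∃ A : Finset ℕ, (∀ j ∈ A, j < k) ∧ (A.image d, d k) ∈ H.E) := by
    intro l d x h1 h2 h3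
    have him : ∀ (A : Finset ℕ) (k : ℕ), (∀ j ∈ A, j < k) → k ≤ l.length →
        A.image (Function.update d l.length x) = A.image d := fun A k hA hk =>
      Finset.image_congr fun j hj => upd d _ j x ((hA j hj).trans_le hk)
    refine ⟨Function.update d l.length x, ?_, ?_⟩
    · intro y hy
      rcases List.mem_cons.1 hy with rfl | hy
      · exact ⟨l.length, by simp, by simp⟩
      · obtain ⟨k, hk, rfl⟩ := h1 y hy
        exact ⟨k, by simp; omega, upd d _ k x hk⟩
    · intro k hk
      rcases Nat.lt_succ_iff_lt_or_eq.1 (by simpa using hk : k < l.length + 1) with hk | rfl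
      · rw [upd d _ k x hk]
        refine ⟨(h2 k hk).1, (h2 k hk).2.imp_right ?_⟩
        rintro ⟨A, hA, hE⟩
        exact ⟨A, hA, by rwa [him A k hA hk.le]⟩
      · rw [Function.update_self]
        refine ⟨h3.1, h3.2.imp_right ?_⟩
        rintro ⟨A, hA, hE⟩
        exact ⟨A, hA, by rwa [him A _ hA le_rfl]⟩
  induction hl with
  | nil => exact ⟨fun _ => x₀, by simp, by simp⟩
  | @leaf l x _ hx hT ih =>
    obtain ⟨d, h1, h2⟩ := ih
    exact ext x h1 h2 ⟨hx, .inl hT⟩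
  | @edge l A x _ he hA ih =>
    obtain ⟨d, h1, h2⟩ := ih
    -- All earlier positions carrying a vertex of `A` are taken as premises; their image is all of
    -- `A` because `A` lies in `l`.
    refine ext x h1 h2 ⟨(H.edge_mem _ he).2, .inr
      ⟨(Finset.range l.length).filter fun j => d j ∈ A, by simp +contextual, ?_⟩⟩
    convert he
    ext y
    simp only [Finset.mem_image, Finset.mem_filter, Finset.mem_range]
    constructor
    · rintro ⟨j, ⟨-, hj⟩, rfl⟩
      exact hj
    · intro hy
      obtain ⟨k, hk, rfl⟩ := h1 y (hA y hy)
      exact ⟨k, ⟨hk, hy⟩, rfl⟩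

/-- A derivation yields a proof of the label of each of its vertices. -/
theorem Derivation.exists_isProof {L : SentLogic.{u, v}} {H : LHypergraph U L.Sentence}
    {T : Finset L.Sentence} {l : List U} (hl : H.Derivation T l)
    (hH : ∀ e ∈ H.E, L.Entails (H.label '' (e.1 : Set U)) (H.label e.2)) {x : U} (hx : x ∈ l) :
    ∃ P : LHypergraph ℕ L.Sentence, P.IsProof L T (H.label x) ∧ (∃ h : ℕ → U, P.IsHom H h) ∧
      P.V.card ≤ l.length := by
  classical
  obtain ⟨d, hd, hV⟩ := hl.exists_seq x
  obtain ⟨k₀, hk₀, rfl⟩ := hd x hx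
  -- One justification is fixed per position: `none` for an axiom, `some A` for a hyperedge with
  -- premise positions `A`, possibly empty. At most one hyperedge then enters each position.
  have hF : ∀ k, ∃ F : Option (Finset ℕ), k < l.length → (F = none → H.label (d k) ∈ T) ∧
      ∀ A, F = some A → (∀ j ∈ A, j < k) ∧ (A.image d, d k) ∈ H.E := by
    intro k
    by_cases hk : k < l.length
    · rcases (hV k hk).2 with h | ⟨A, hA⟩
      · exact ⟨none, fun _ => ⟨fun _ => h, by simp⟩⟩
      · exact ⟨some A, fun _ => ⟨by simp, by rintro _ ⟨⟩; exact hA⟩⟩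
    · exact ⟨none, fun h => absurd h hk⟩
  choose F hF using hF
  let R : ℕ → ℕ → Prop := fun j k => k < l.length ∧ ∃ A, F k = some A ∧ j ∈ A
  have hR : ∀ {j k}, R j k → j < k := fun ⟨hk, A, hA, hj⟩ => ((hF _ hk).2 A hA).1 _ hj
  -- Only positions that contribute to `k₀` are kept, which makes `k₀` the unique sink; acyclicity
  -- holds because hyperedges only lead to larger positions.
  let V : Finset ℕ := (Finset.range l.length).filter fun j => Relation.ReflTransGen R j k₀
  have memV : ∀ {j}, j ∈ V ↔ j < l.length ∧ Relation.ReflTransGen R j k₀ := by simp [V]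
  let E : Finset (Finset ℕ × ℕ) :=
    (V.filter fun k => (F k).isSome).image fun k => ((F k).getD ∅, k)
  have memE : ∀ {e}, e ∈ E ↔ e.2 ∈ V ∧ F e.2 = some e.1 := by
    rintro ⟨A, k⟩
    simp only [E, Finset.mem_image, Finset.mem_filter, Option.isSome_iff_exists, Prod.mk.injEq]
    constructor
    · rintro ⟨k, ⟨hk, A, hA⟩, h1, rfl⟩
      exact ⟨hk, by simpa [hA] using h1⟩
    · rintro ⟨hk, hA⟩
      exact ⟨k, ⟨hk, A, hA⟩, by simp [hA], rfl⟩
  let P : LHypergraph ℕ L.Sentence := ⟨V, E, fun k => H.label (d k), by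
    intro e he
    obtain ⟨hk, hA⟩ := memE.1 he
    obtain ⟨hlt, hr⟩ := memV.1 hk
    refine ⟨fun j hj => memV.2 ⟨?_, .head ⟨hlt, _, hA, hj⟩ hr⟩, hk⟩
    exact (((hF _ hlt).2 _ hA).1 j hj).trans hlt⟩
  have hedge : ∀ e ∈ P.E, (e.1.image d, d e.2) ∈ H.E := fun e he =>
    ((hF _ (memV.1 (memE.1 he).1).1).2 _ (memE.1 he).2).2
  have hstep : ∀ {j k}, P.Step j k → j < k := by
    rintro j k ⟨e, he, hj, rfl⟩
    exact ((hF _ (memV.1 (memE.1 he).1).1).2 _ (memE.1 he).2).1 j hj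
  have hle : ∀ {j k}, Relation.ReflTransGen R j k → j ≤ k := by
    intro j k h
    induction h with
    | refl => exact le_rfl
    | tail _ h ih => exact ih.trans (hR h).le
  refine ⟨P, ⟨⟨?_, ?_⟩, ⟨k₀, ⟨memV.2 ⟨hk₀, .refl⟩, ?_⟩, rfl, ?_⟩, ?_⟩, ⟨d, ?_, hedge, fun _ _ => rfl⟩,
    ?_⟩
  · rintro k ⟨hk, hleaf⟩
    refine (hF k (memV.1 hk).1).1 ?_
    by_contra hne
    obtain ⟨A, hA⟩ := Option.ne_none_iff_exists'.1 hne
    exact hleaf (A, k) (memE.2 ⟨hk, hA⟩) rfl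
  · intro e he
    have := hH _ (hedge e he)
    simpa [P, Set.image_image] using this
  · intro e he hmem
    have h1 := hstep ⟨e, he, hmem, rfl⟩
    have h2 := hle (memV.1 (memE.1 he).1).2
    omega
  · rintro k ⟨hk, hsink⟩
    rcases Relation.ReflTransGen.cases_head (memV.1 hk).2 with h | ⟨j, ⟨hj, A, hA, hkA⟩, hr⟩
    · exact h
    · exact absurd hkA (hsink (A, j) (memE.2 ⟨memV.2 ⟨hj, hr⟩, hA⟩))
  · intro k hk
    have : ∀ {j}, Relation.TransGen P.Step k j → k < j := by
      intro j h
      induction h with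
      | single h => exact hstep h
      | tail _ h ih => exact ih.trans (hstep h)
    exact lt_irrefl _ (this hk)
  · exact fun k hk => (hV k (memV.1 hk).1).1
  · exact (Finset.card_filter_le _ _).trans (by simp)

end LHypergraph

/-- An instance is a yes-instance iff a vertex labelled by the goal can be derived in at most
`bound` steps. -/
theorem Deriver.mem_MP_iff {L : SentLogic.{u, v}} {D : Deriver.{u, v, w} L} (i : D.MPInstance) :
    i ∈ D.MP ↔ ∃ l, i.derivation.Derivation i.theory l ∧ l.length ≤ i.bound ∧
      ∃ x ∈ l, i.derivation.label x = i.goal := by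
  constructor
  · rintro ⟨U, P, ⟨⟨hT, -⟩, ⟨x, hx, hη, -⟩, hac⟩, ⟨h, hh⟩, hcard⟩
    obtain ⟨l, hl, hlen, hmem⟩ := LHypergraph.exists_derivation_of_isHom hh hac hT
    exact ⟨l, hl, by omega, h x, hmem x hx.1, (hh.2.2 x hx.1).trans hη⟩
  · rintro ⟨l, hl, hlen, x, hx, hη⟩
    obtain ⟨P, hP, hh, hcard⟩ := hl.exists_isProof (D.isDerivationStructure _ _).2 hx
    exact ⟨ℕ, P, hη ▸ hP, hh, hcard.trans hlen⟩

/-! ### Verification -/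

theorem Polynomial.eval_mono_nat (p : Polynomial ℕ) {a b : ℕ} (h : a ≤ b) :
    p.eval a ≤ p.eval b := by
  rw [Polynomial.eval_eq_sum, Polynomial.eval_eq_sum]
  exact Finset.sum_le_sum fun k _ => Nat.mul_le_mul_left _ (Nat.pow_le_pow_left h k)

theorem Computability.length_encodeNat (n : ℕ) : (Computability.encodeNat n).length = n.size := by
  have hp : ∀ n : PosNum, (Computability.encodePosNum n).length = n.natSize := by
    intro n
    induction n with
    | one => rfl
    | bit0 n ih => simp [Computability.encodePosNum, PosNum.natSize, ih]
    | bit1 n ih => simp [Computability.encodePosNum, PosNum.natSize, ih]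
  have hn : ∀ n : Num, (Computability.encodeNum n).length = n.natSize := by
    rintro (_ | n)
    · rfl
    · exact hp n
  rw [Computability.encodeNat, hn, Num.natSize_to_nat, Num.to_of_nat]

theorem Computability.encodeNat_injective : Function.Injective Computability.encodeNat :=
  Function.LeftInverse.injective Computability.decode_encodeNat

namespace ProofChecker

variable {L : SentLogic.{u, v}} {D : Deriver.{u, v, w} L} (c : SentenceCoding L)
  (N : D.Numbering) (i : D.MPInstance)

/-- The binary index of a vertex. -/
noncomputable def vertexWord (x : D.Vertex) : List Bool := Computability.encodeNat (N.num i.theory i.goal x)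

theorem vertexWord_inj {x y : D.Vertex} (hx : x ∈ i.derivation.V) (hy : y ∈ i.derivation.V)
    (h : vertexWord N i x = vertexWord N i y) : x = y :=
  (N.bijOn i.theory i.goal).injOn hx hy (Computability.encodeNat_injective h)

theorem edgeQuery_eq (xs : List D.Vertex) (x : D.Vertex) :
    Deriver.edgeQuery (xs.map (N.num i.theory i.goal)) (N.num i.theory i.goal x) =
      .edge :: (items .vertex (xs.map (vertexWord N i)) ++ items .vertex [vertexWord N i x]) := by
  simp [Deriver.edgeQuery, items, Deriver.indexWord, vertexWord, List.flatMap_map]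

theorem labelQuery_eq (x : D.Vertex) (α : L.Sentence) :
    Deriver.labelQuery c (N.num i.theory i.goal x) α =
      .label :: (items .vertex [vertexWord N i x] ++ items .sentence [c.enc α]) := by
  simp [Deriver.labelQuery, items, Deriver.indexWord, vertexWord, Deriver.sentenceWord]

/-- Puts queries into the form produced by the machine. Describing `A` by membership allows any
order and repetition of premises and keeps decidability instances out of later arguments. -/
theorem mem_oracle {q : List MPSym} : q ∈ i.oracle c N ↔
    (∃ (xs : List D.Vertex) (A : Finset D.Vertex) (x : D.Vertex), (∀ y, y ∈ A ↔ y ∈ xs) ∧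
      (A, x) ∈ i.derivation.E ∧ q = .edge :: (items .vertex (xs.map (vertexWord N i)) ++
        items .vertex [vertexWord N i x])) ∨
    ∃ x ∈ i.derivation.V, q = .label :: (items .vertex [vertexWord N i x] ++
      items .sentence [c.enc (i.derivation.label x)]) := by
  classical
  simp only [Deriver.MPInstance.oracle, Set.mem_ofPred_eq, edgeQuery_eq, labelQuery_eq]
  refine or_congr ⟨?_, ?_⟩ ⟨?_, ?_⟩
  · rintro ⟨xs, x, h, rfl⟩
    exact ⟨xs, _, x, fun y => List.mem_toFinset, h, rfl⟩
  · rintro ⟨xs, A, x, hA, h, rfl⟩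
    refine ⟨xs, x, ?_, rfl⟩
    convert h
    ext y
    rw [List.mem_toFinset, hA]
  · rintro ⟨x, α, hx, rfl, rfl⟩
    exact ⟨x, hx, rfl⟩
  · rintro ⟨x, hx, rfl⟩
    exact ⟨x, _, hx, rfl, rfl⟩

theorem mem_theory_iff {α : L.Sentence} : α ∈ i.theory ↔ c.enc α ∈ i.axioms.map c.enc := by
  classical
  simp [Deriver.MPInstance.theory, c.enc_injective.eq_iff]

theorem items_vertex (ds : List (List Bool)) :
    items .vertex ds = (ds.map (Prod.mk true)).flatMap fun d => marker d.1 :: d.2.map .bit :=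
  items_eq_flatMap marker true ds

theorem items_sentence (ds : List (List Bool)) :
    items .sentence ds = (ds.map (Prod.mk false)).flatMap fun d => marker d.1 :: d.2.map .bit :=
  items_eq_flatMap marker false ds

variable {c N i}

/-! ### Soundness: accepted certificates yield derivations -/

/-- A positive answer to the query of an ordinary line extends the derivation. -/
theorem exists_derivation_cons {l : List D.Vertex} (hl : i.derivation.Derivation i.theory l)
    {p : MPSym} {ws ts : List (List Bool)} {d : List Bool}
    (hws : ws ⊆ l.map (vertexWord N i)) (hts : ts ⊆ i.axioms.map c.enc)
    (h : p :: (items .vertex ws ++ (items .vertex [d] ++ items .sentence ts)) ∈ i.oracle c N) :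
    ∃ x, d = vertexWord N i x ∧ i.derivation.Derivation i.theory (x :: l) := by
  rw [mem_oracle] at h
  simp only [items_vertex, items_sentence, ← List.flatMap_append, List.cons.injEq] at h
  rcases h with ⟨xs, A, x, hA, hE, -, h⟩ | ⟨x, hx, -, h⟩
  · replace h := items_inj h
    -- A hyperedge query ends with a vertex word, so a selected axiom would contradict unique
    -- readability.
    rcases List.eq_nil_or_concat ts with rfl | ⟨ts, t, rfl⟩
    · simp only [List.map_nil, List.append_nil, List.map_cons, List.append_singleton_inj,
        Prod.mk.injEq, true_and] at h
      obtain ⟨h, rfl⟩ := h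
      replace h := List.map_injective_iff.2 (Prod.mk_right_injective true) h
      subst h
      refine ⟨x, rfl, hl.edge hE fun y hy => ?_⟩
      obtain ⟨z, hz, hzy⟩ := List.mem_map.1
        (hws (List.mem_map_of_mem (f := vertexWord N i) ((hA y).1 hy)))
      rwa [← vertexWord_inj N i (hl.mem_V z hz) ((i.derivation.edge_mem _ hE).1 hy) hzy]
    · have hmem : (false, t) ∈ (xs.map (vertexWord N i)).map (Prod.mk true) ++
          [vertexWord N i x].map (Prod.mk true) := by
        rw [← h]
        simp
      simp at hmem
  · replace h := items_inj h
    rcases ws with _ | ⟨w, ws⟩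
    · simp only [List.map_nil, List.nil_append, List.map_cons, List.cons_append, List.cons.injEq,
        Prod.mk.injEq, true_and] at h
      obtain ⟨rfl, h⟩ := h
      obtain rfl : ts = [c.enc (i.derivation.label x)] :=
        List.map_injective_iff.2 (Prod.mk_right_injective false) h
      exact ⟨x, rfl, hl.leaf hx ((mem_theory_iff c i).2 (hts (by simp)))⟩
    -- A label query has exactly one vertex word, and `d` already supplies it, so no earlier vertex
    -- can have been selected.
    · rcases ws with _ | ⟨w', ws⟩ <;> simp at h

/-- A positive answer to the query of the final line shows that the goal has been derived. -/
theorem exists_mem_of_goal_query {l : List D.Vertex} (hl : i.derivation.Derivation i.theory l)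
    {ws ts : List (List Bool)} (hws : ws ⊆ l.map (vertexWord N i))
    (h : .label :: (items .vertex ws ++ (items .sentence ts ++
      .sentence :: (c.enc i.goal).map .bit)) ∈ i.oracle c N) :
    ∃ x ∈ l, i.derivation.label x = i.goal := by
  have e : MPSym.sentence :: (c.enc i.goal).map .bit = items .sentence [c.enc i.goal] := by
    simp [items]
  rw [e, mem_oracle] at h
  simp only [items_vertex, items_sentence, ← List.flatMap_append, List.cons.injEq, reduceCtorEq,
    false_and, and_false, exists_false, false_or, true_and] at h
  obtain ⟨x, hx, h⟩ := h
  replace h := items_inj h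
  simp only [List.map_cons, List.map_nil, ← List.append_assoc, List.append_singleton_inj,
    Prod.mk.injEq, true_and] at h
  obtain ⟨h, hg⟩ := h
  rcases ws with _ | ⟨w, ws⟩
  · rcases ts with _ | ⟨t, ts⟩ <;> simp at h
  · simp only [List.map_cons, List.cons_append, List.cons.injEq, Prod.mk.injEq, true_and] at h
    obtain ⟨rfl, -⟩ := h
    obtain ⟨z, hz, hzx⟩ := List.mem_map.1 (hws List.mem_cons_self)
    rw [← vertexWord_inj N i (hl.mem_V z hz) hx hzx] at hg
    exact ⟨z, hz, (c.enc_injective hg).symm⟩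

/-- Induction on the remaining bound: an ordinary line adds one entry for one unit, the final line
ends the run. Derivations list the latest vertex first and the store the earliest first, whence the
reversal. -/
theorem exists_derivation_of_accepts {n : ℕ} {l : List D.Vertex} {w : List MPSym}
    (hl : i.derivation.Derivation i.theory l)
    (h : Accepts (i.oracle c N) (lineCfg (l.map (vertexWord N i)).reverse (i.axioms.map c.enc)
      (c.enc i.goal) n w)) :
    ∃ l', i.derivation.Derivation i.theory l' ∧ l'.length ≤ l.length + n ∧
      ∃ x ∈ l', i.derivation.label x = i.goal := by
  have hsub : ∀ w, pick (l.map (vertexWord N i)).reverse w ⊆ l.map (vertexWord N i) :=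
    fun w => List.Subset.trans (pick_subset _ w) (List.reverse_subset.2 (List.Subset.refl _))
  induction n generalizing l w with
  | zero =>
    rcases accepts_lineCfg_cases h with ⟨w', hw'⟩ | ⟨_, _, _, _, m, _, hm, _⟩
    · exact ⟨l, hl, by omega, exists_mem_of_goal_query hl (hsub w') hw'⟩
    · omega
  | succ n ih =>
    rcases accepts_lineCfg_cases h with ⟨w', hw'⟩ | ⟨p, w₁, w₂, d, m, _, hm, hq, hacc⟩
    · exact ⟨l, hl, by omega, exists_mem_of_goal_query hl (hsub w') hw'⟩
    · obtain rfl : n = m := by omega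
      obtain ⟨x, rfl, hx⟩ := exists_derivation_cons hl (hsub w₁) (pick_subset _ w₂) hq
      obtain ⟨l', h1, h2, h3⟩ := ih hx (by simpa using hacc) (fun w =>
        List.Subset.trans (pick_subset _ w) (List.reverse_subset.2 (List.Subset.refl _)))
      exact ⟨l', h1, by simp at h2; omega, h3⟩

/-! ### Completeness: derivations yield certificates -/

@[simp] theorem pick_nil (ds : List (List Bool)) : pick ds [] = [] := by
  induction ds with
  | nil => rfl
  | cons d ds ih => simpa [pick] using ih

/-- The lines of a certificate for a derivation. -/
theorem exists_certificate {l : List D.Vertex} (hl : i.derivation.Derivation i.theory l)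
    {B : ℕ} (hB : ∀ x ∈ l, l.length + (vertexWord N i x).length + i.axioms.length + 2 ≤ B) (m : ℕ) :
    ∃ u : List MPSym, u.length ≤ l.length * B ∧ ∀ w,
      Accepts (i.oracle c N) (lineCfg (l.map (vertexWord N i)).reverse (i.axioms.map c.enc)
        (c.enc i.goal) m w) →
      Accepts (i.oracle c N) (lineCfg [] (i.axioms.map c.enc) (c.enc i.goal) (l.length + m)
        (u ++ w)) := by
  classical
  -- Both rules of a derivation add a line of the same shape. It is appended to the previous lines,
  -- which are taken for the counter `m + 1` since the new line uses one unit.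
  have ext : ∀ {l : List D.Vertex} {x : D.Vertex} {p : MPSym} {ws ts : List (List Bool)} (m : ℕ),
      (∀ y ∈ x :: l, (x :: l).length + (vertexWord N i y).length + i.axioms.length + 2 ≤ B) →
      ((∀ y ∈ l, l.length + (vertexWord N i y).length + i.axioms.length + 2 ≤ B) → ∀ m,
        ∃ u : List MPSym, u.length ≤ l.length * B ∧ ∀ w,
        Accepts (i.oracle c N) (lineCfg (l.map (vertexWord N i)).reverse (i.axioms.map c.enc)
          (c.enc i.goal) m w) →
        Accepts (i.oracle c N) (lineCfg [] (i.axioms.map c.enc) (c.enc i.goal) (l.length + m)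
          (u ++ w))) →
      (p = .edge ∨ p = .label) → ws.Sublist (l.map (vertexWord N i)).reverse →
      ts.Sublist (i.axioms.map c.enc) →
      p :: (items .vertex ws ++ (items .vertex [vertexWord N i x] ++ items .sentence ts)) ∈
        i.oracle c N →
      ∃ u : List MPSym, u.length ≤ (x :: l).length * B ∧ ∀ w,
        Accepts (i.oracle c N) (lineCfg ((x :: l).map (vertexWord N i)).reverse
          (i.axioms.map c.enc) (c.enc i.goal) m w) →
        Accepts (i.oracle c N) (lineCfg [] (i.axioms.map c.enc) (c.enc i.goal)
          ((x :: l).length + m) (u ++ w)) := by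
    intro l x p ws ts m hB ih hp hws hts hq
    obtain ⟨u, hu, hacc⟩ := ih (fun y hy => by
      have := hB y (List.mem_cons_of_mem _ hy)
      simp only [List.length_cons] at this
      omega) (m + 1)
    obtain ⟨m₁, hm₁, hpick₁⟩ := exists_pick hws
    obtain ⟨m₂, hm₂, hpick₂⟩ := exists_pick hts
    -- The symbol `.goal` here only terminates the index word; any symbol other than a bit would do.
    -- Head and terminator account for the `2` in the bound on `B`.
    refine ⟨u ++ p :: (m₁ ++ ((vertexWord N i x).map .bit ++ .goal :: m₂)), ?_, fun w hw => ?_⟩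
    · have := hB x List.mem_cons_self
      simp only [List.length_cons, List.length_append, List.length_map, List.length_reverse,
        Nat.add_mul] at this hm₁ hm₂ ⊢
      omega
    · have := hacc (p :: (m₁ ++ ((vertexWord N i x).map .bit ++ .goal :: (m₂ ++ w)))) (by
        rw [accepts_lineCfg_step hp (s := .goal) rfl (d := vertexWord N i x) (w' := m₂ ++ w)
          (by rw [← hm₁, List.drop_left])]
        refine ⟨m, rfl, ?_, ?_⟩
        · rwa [hpick₁, hpick₂]
        · rw [← hm₂, List.drop_left]
          simpa using hw)
      have e : (x :: l).length + m = l.length + (m + 1) := by simp; omega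
      rw [e]
      simpa using this
  induction hl generalizing m with
  | nil => exact ⟨[], by simp, fun w hw => by simpa using hw⟩
  | @leaf l x hl hx hT ih =>
    refine ext (p := .label) (ws := []) (ts := [c.enc (i.derivation.label x)]) m hB ih (.inr rfl)
      (List.nil_sublist _) (List.singleton_sublist.2 ((mem_theory_iff c i).1 hT)) ?_
    exact (mem_oracle c N i).2 (.inr ⟨x, hx, by simp [items]⟩)
  | @edge l A x hl hE hA ih =>
    refine ext (p := .edge) (ws := (l.reverse.filter (· ∈ A)).map (vertexWord N i)) (ts := []) m hB
      ih (.inl rfl) ?_ (List.nil_sublist _) ?_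
    · rw [← List.map_reverse]
      exact List.filter_sublist.map _
    · refine (mem_oracle c N i).2 (.inl ⟨l.reverse.filter (· ∈ A), A, x, fun y => ?_, hE,
        by simp [items]⟩)
      simpa using hA y

theorem exists_accepts_of_derivation {l : List D.Vertex}
    (hl : i.derivation.Derivation i.theory l) (hlen : l.length ≤ i.bound) {B : ℕ}
    (hB : ∀ x ∈ l, l.length + (vertexWord N i x).length + i.axioms.length + 2 ≤ B)
    {x : D.Vertex} (hx : x ∈ l) (hg : i.derivation.label x = i.goal) :
    ∃ w : List MPSym, w.length ≤ l.length * B + (l.length + 1) ∧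
      Accepts (i.oracle c N) (lineCfg [] (i.axioms.map c.enc) (c.enc i.goal) i.bound w) := by
  obtain ⟨u, hu, hacc⟩ := exists_certificate (c := c) hl hB (i.bound - l.length)
  obtain ⟨m₁, hm₁, hpick⟩ := exists_pick (D := (l.map (vertexWord N i)).reverse)
    (D' := [vertexWord N i x]) (List.singleton_sublist.2 (by simpa using ⟨x, hx, rfl⟩))
  refine ⟨u ++ .goal :: m₁, ?_, ?_⟩
  · simp at hm₁ ⊢
    omega
  · have := hacc (.goal :: m₁) (by
      -- The certificate ends after the vertex selection, so no axiom is picked and the query has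
      -- exactly one vertex and one sentence.
      rw [accepts_lineCfg_goal, ← hm₁, List.drop_length, pick_nil, ← List.append_nil m₁, hpick]
      exact (mem_oracle c N i).2 (.inr ⟨x, hl.mem_V x hx, by simp [items, hg]⟩))
    rwa [Nat.add_sub_cancel' hlen] at this

/-! ### Polynomial bounds in the input length -/

theorem edge_cons_encode : MPSym.edge :: i.encode c =
    storeWord [] (i.axioms.map c.enc) (c.enc i.goal) i.bound := by
  simp [Deriver.MPInstance.encode, storeWord, items, Deriver.sentenceWord, List.flatMap_map]

theorem bound_le_length_encode : i.bound ≤ (i.encode c).length := by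
  simp [Deriver.MPInstance.encode]; omega

theorem length_enc_goal_le : (c.enc i.goal).length ≤ (i.encode c).length := by
  simp [Deriver.MPInstance.encode, Deriver.sentenceWord]; omega

theorem length_enc_le {α : L.Sentence} (hα : α ∈ i.axioms) :
    (c.enc α).length ≤ (i.encode c).length := by
  have : (c.enc α).length ≤
      (i.axioms.flatMap fun α => MPSym.sentence :: Deriver.sentenceWord c α).length := by
    obtain ⟨s, t, e⟩ := List.append_of_mem hα
    simp [e, Deriver.sentenceWord]; omega
  simp only [Deriver.MPInstance.encode, List.length_append]; omega

theorem length_axioms_le : i.axioms.length ≤ (i.encode c).length := by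
  have : ∀ l : List L.Sentence, l.length ≤
      (l.flatMap fun α => MPSym.sentence :: Deriver.sentenceWord c α).length := by
    intro l
    induction l with
    | nil => simp
    | cons a l ih => simp only [List.flatMap_cons, List.length_append, List.length_cons]; omega
  have := this i.axioms
  simp only [Deriver.MPInstance.encode, List.length_append]; omega

/-- The theory has at most as many sentences as the input has symbols, each of size at most `p` of
the input length; the goal accounts for the `+ 1`. -/
theorem size_le_eval_encode {p : Polynomial ℕ}
    (hp : ∀ α, L.size α ≤ p.eval (c.enc α).length) :
    L.theorySize i.theory + L.size i.goal ≤
      ((Polynomial.X + 1) * p).eval (i.encode c).length := by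
  classical
  have h1 : L.size i.goal ≤ p.eval (i.encode c).length :=
    (hp _).trans (p.eval_mono_nat length_enc_goal_le)
  have h2 : L.theorySize i.theory ≤ i.theory.card • p.eval (i.encode c).length :=
    Finset.sum_le_card_nsmul _ _ _ fun α hα => (hp α).trans (p.eval_mono_nat (length_enc_le
      (by simpa [Deriver.MPInstance.theory] using hα)))
  have h3 : i.theory.card ≤ (i.encode c).length :=
    (List.toFinset_card_le _).trans length_axioms_le
  have h4 := Nat.mul_le_mul_right (p.eval (i.encode c).length) h3
  simp only [smul_eq_mul, Polynomial.eval_mul, Polynomial.eval_add, Polynomial.eval_X,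
    Polynomial.eval_one, Nat.add_mul] at h2 ⊢
  omega

theorem length_vertexWord_le {p : Polynomial ℕ} (hp : ∀ T (η : D.C),
    (D.graph T η).V.card.size ≤ p.eval (L.theorySize T + L.size η)) {x : D.Vertex}
    (hx : x ∈ i.derivation.V) :
    (vertexWord N i x).length ≤ p.eval (L.theorySize i.theory + L.size i.goal) := by
  rw [vertexWord, Computability.length_encodeNat]
  exact (Nat.size_le_size ((N.bijOn i.theory i.goal).mapsTo hx).2).trans (hp _ _)

end ProofChecker

open ProofChecker in
theorem mainTheorem7 (L : SentLogic.{u, v}) (c : SentenceCoding L) (D : Deriver.{u, v, w} L)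
    (hD : D.IsExponential) (N : D.Numbering) (hN : N.HasPolynomialIndices) :
    InOracleNP (fun i : D.MPInstance => i.encode c) (fun i => i.oracle c N) D.MP := by
  obtain ⟨p, hp⟩ := c.size_le
  obtain ⟨r, hr⟩ := hN
  -- At most `X` lines, each of length at most the number of lines plus index length plus number of
  -- axioms plus 2; then the final line with its head symbol.
  let q : Polynomial ℕ := .X * (.X + r.comp ((.X + 1) * p) + .X + 2) + (.X + 1)
  -- The bound of `haltsWithin` with the certificate length replaced by `q`.
  let t : Polynomial ℕ := (4 * (.X + 1 + q) + 5) * q + 2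
  have halt : ∀ (i : D.MPInstance) (w : List MPSym), w.length ≤ q.eval (i.encode c).length →
      proofChecker.HaltsWithin (i.oracle c N) (i.encode c) w (t.eval (i.encode c).length) := by
    intro i w hw
    apply haltsWithin
    simp only [t, Polynomial.eval_mul, Polynomial.eval_add, Polynomial.eval_X,
      Polynomial.eval_one, Polynomial.eval_ofNat]
    gcongr
  refine ⟨proofChecker, q, t, halt, fun i => ?_⟩
  rw [Deriver.mem_MP_iff]
  constructor
  · rintro ⟨l, hl, hlen, x, hx, hg⟩
    have hn : l.length ≤ (i.encode c).length := hlen.trans bound_le_length_encode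
    obtain ⟨w, hw, hacc⟩ := exists_accepts_of_derivation (c := c) (N := N) hl hlen
      (B := (i.encode c).length + r.eval (((Polynomial.X + 1) * p).eval (i.encode c).length) +
        (i.encode c).length + 2) (fun y hy => by
        have h1 := (length_vertexWord_le (N := N) hr (hl.mem_V y hy)).trans
          (r.eval_mono_nat (size_le_eval_encode (c := c) hp))
        have h2 := length_axioms_le (c := c) (i := i)
        omega) hx hg
    have hw' : w.length ≤ q.eval (i.encode c).length := by
      refine hw.trans ?_
      simp only [q, Polynomial.eval_mul, Polynomial.eval_add, Polynomial.eval_X,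
        Polynomial.eval_one, Polynomial.eval_ofNat, Polynomial.eval_comp]
      gcongr
    exact ⟨w, hw', (acceptsWithin_iff_lineCfg edge_cons_encode (halt i w hw')).2 hacc⟩
  · rintro ⟨w, hw, hacc⟩
    obtain ⟨l, hl, hlen, hg⟩ := exists_derivation_of_accepts (l := []) .nil
      ((acceptsWithin_iff_lineCfg edge_cons_encode (halt i w hw)).1 hacc)
    exact ⟨l, hl, by simpa using hlen, hg⟩
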